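/- Fix an integer $p\ge 2$. A \emph{$p$-hypermap} is an embedding of a finite connected graph (loops and multiple edges allowed) into the sphere, up to orientation-preserving homeomorphism, whose faces are shaded dark or light so that adjacent faces have different shades and every dark face has degree $p$. It has \emph{type} $\boldsymbol a=(a_1,\dots,a_r)$ if it has exactly $r$ light faces, numbered $f_1,\dots,f_r$, of respective degrees $a_1,\dots,a_r$, each bearing one marked corner. A marked corner, seen as a dangling half-edge, counts as two corners, one on each side of it, so that a light face of degree $a$ has $a+1$ corners to distinguish. An \emph{orientation} $\mathcal O$ is light-left or light-right: all edges are oriented with the light faces to their left, respectively right; $\tilde{\mathcal O}$ is the reverse orientation. In a given orientation, $e^-$ and $e^+$ are the origin and the end of the edge $e$, $c^+$ is the vertex at the corner $c$, $\vec d(v,w)$ is the smallest length of a directed path from $v$ to $w$, and $e$ is \emph{leaving} $v$ if $\vec d(v,e^+)=\vec d(v,e^-)+1$. The \emph{lightest geodesic} from a corner to a vertex $v'$ is the directed path that at each step, until $v'$ is reached, takes the first edge $e$ with $\vec d(e^+,v')=\vec d(e^-,v')-1$ met when turning around the current vertex, from the starting corner or from the last edge of the path, in the direction incoming edge, light face.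 The mapping $\Phi$ sends a quadruple $(\mathcal O,\mathfrak m,c,e)$, where $\mathfrak m$ is a $p$-hypermap, $c$ a corner of a light face, and $e$ an edge leaving $c^+$ in the orientation $\mathcal O$, to the quadruple $(\tilde{\mathcal O},\tilde{\mathfrak m},\tilde c,\tilde e)$ obtained as follows. In the orientation $\tilde{\mathcal O}$, let $\gamma=(e_1,\dots,e_k)$ be the lightest geodesic to $c^+$ from the corner $c_e$ directly preceding $e$ on the contour of its light face. Slit $\mathfrak m$ along $\gamma$, entering from $c_e$ and exiting through $c$; let $\ell_i$ and $d_i$ be the copies of $e_i$ incident to a light, respectively dark, face. Sew $\ell_{i+1}$ onto $d_i$ for $1\le i\le k-1$. The unmatched $\ell_1$ is a dangling edge; it is removed and leaves the corner $\tilde c$. The unmatched $d_k$ is the edge $\tilde e$. The resulting map is $\tilde{\mathfrak m}$. Let $r\ge 2$ and let $\boldsymbol a=(a_1,\dots,a_r)$ be a tuple of positive integers with $a_1\ge 2$ whose coordinates are, modulo $p$, equal either to $(k,-k,0,\dots,0)$ for some $k\in\{0,\dots,p-1\}$, or to $(1,0,\dots,0,-1,0,\dots,0)$ with the $-1$ in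 any position from $3$ to $r$. Let $\tilde{\boldsymbol a}=(a_1-1,a_2+1,a_3,\dots,a_r)$ and fix an orientation $\mathcal O$. Let $\mathcal M$ be the set of triples $(\mathfrak m,c,e)$, where $\mathfrak m$ is a $p$-hypermap of type $\boldsymbol a$, $c$ is a distinguished corner in its second light face, and $e$ is a distinguished edge incident to its first light face and leaving $c^+$ for the orientation $\mathcal O$. Let $\tilde{\mathcal M}$ be the set of triples $(\tilde{\mathfrak m},\tilde c,\tilde e)$, where $\tilde{\mathfrak m}$ is a $p$-hypermap of type $\tilde{\boldsymbol a}$, $\tilde c$ is a distinguished corner in its first light face, and $\tilde e$ is a distinguished edge incident to its second light face and leaving $\tilde c^+$ for the reverse orientation $\tilde{\mathcal O}$. Then $\Phi$ specializes into a bijection from $\{(\mathcal O,\mathfrak m,c,e):(\mathfrak m,c,e)\in\mathcal M\}$ onto $\{(\tilde{\mathcal O},\tilde{\mathfrak m},\tilde c,\tilde e):(\tilde{\mathfrak m},\tilde c,\tilde e)\in\tilde{\mathcal M}\}$, and thus provides a bijection between $\mathcal M$ and $\tilde{\mathcal M}$. -/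

import Mathlib

open Equiv

namespace Hypermap

/-- The two orientations of the edges: all the light faces lie to the left of the oriented edges,
or all of them lie to their right. -/
inductive Orientation
  | lightLeft
  | lightRight

/-- The reverse orientation. -/
def Orientation.reverse : Orientation → Orientation
  | .lightLeft => .lightRight
  | .lightRight => .lightLeft

/-- Combinatorial encoding of a map on an oriented surface with shaded faces, each edge being
incident to one light and one dark face, and with `r` numbered marked corners in light faces.

A marked corner is seen as a dangling half-edge inside its light face, so that the boundary of
a light face, read in the light-left orientation, is a cyclic sequence of *items*: the edges
incident to the face and the marks it contains. The permutation `contour` sends an item to the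
next one around its light face in the light-left orientation (counterclockwise). The permutation
`dark` sends an edge to the next one around its dark face in the light-left orientation
(clockwise around the dark face). The map is the gluing of these light and dark polygons. -/
structure MapData (r : ℕ) where
  /-- the set of edges -/
  Edge : Type
  /-- there are finitely many edges -/
  finite : Finite Edge
  /-- rotation around light faces, marks included -/
  contour : Perm (Edge ⊕ Fin r)
  /-- rotation around dark faces -/
  dark : Perm Edge

namespace MapData

variable {r : ℕ} (m : MapData r)

/-- Items on the contours of the light faces: edges and marks. -/
abbrev Item : Type := m.Edge ⊕ Fin r

/-- Corners of light faces, where a marked corner is split into two corners, one on each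
side of the mark. Each corner is named by the item following it in the light-left orientation. A
light face with `a` edges and one mark has `a + 1` corners. -/
abbrev Corner : Type := m.Edge ⊕ Fin r

/-- The successor of an item around its light face, in the orientation `O`. -/
def contourIn : Orientation → Perm m.Item
  | .lightLeft => m.contour
  | .lightRight => m.contour⁻¹

/-- The successor of an edge around its dark face, in the orientation `O`. -/
def darkIn : Orientation → Perm m.Edge
  | .lightLeft => m.dark
  | .lightRight => m.dark⁻¹

/-- The corner directly before an item, in the orientation `O`. -/
def cornerBefore : Orientation → m.Item → m.Corner
  | .lightLeft, x => x
  | .lightRight, x => m.contour x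

/-- The corner directly after an item, in the orientation `O`. -/
def cornerAfter : Orientation → m.Item → m.Corner
  | .lightLeft, x => m.contour x
  | .lightRight, x => x

/-- The item directly following a corner, in the orientation `O`. -/
def itemAfter : Orientation → m.Corner → m.Item
  | .lightLeft, c => c
  | .lightRight, c => m.contour⁻¹ c

/-- Turning around a vertex, from an outgoing edge or a mark to the next outgoing edge or mark, in
the direction going from an incoming edge into the light face incident to this edge: from an
outgoing edge one crosses the dark face to an incoming edge, and then goes into the light
face incident to that edge; from a mark one stays in the same light face. -/
def turnIn (O : Orientation) : Perm m.Item :=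
  m.contourIn O * Perm.sumCongr (m.darkIn O)⁻¹ 1

/-- The vertices: the classes of corners obtained from one another by turning around a vertex. -/
def Vertex : Type := Quotient (Perm.SameCycle.setoid (m.turnIn .lightLeft))

/-- The vertex `c⁺` incident to a corner `c`. -/
def cornerVertex (c : m.Corner) : m.Vertex :=
  Quotient.mk (Perm.SameCycle.setoid (m.turnIn .lightLeft)) c

/-- The origin `e⁻` of an edge in the orientation `O`. -/
def origin (O : Orientation) (e : m.Edge) : m.Vertex :=
  m.cornerVertex (m.cornerBefore O (Sum.inl e))

/-- The end `e⁺` of an edge in the orientation `O`. -/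
def terminus (O : Orientation) (e : m.Edge) : m.Vertex :=
  m.cornerVertex (m.cornerAfter O (Sum.inl e))

/-- `m.IsPath O v w l`: the list of edges `l` is a path from `v` to `w` in the orientation `O`. -/
def IsPath (O : Orientation) : m.Vertex → m.Vertex → List m.Edge → Prop
  | v, w, [] => v = w
  | v, w, e :: l => m.origin O e = v ∧ IsPath O (m.terminus O e) w l

/-- The directed distance: the smallest length of a path from `v` to `w`. -/
noncomputable def dist (O : Orientation) (v w : m.Vertex) : ℕ :=
  sInf {k | ∃ l, m.IsPath O v w l ∧ l.length = k}

/-- The edge `e` is leaving the vertex `v`, in the orientation `O`. -/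
def IsLeaving (O : Orientation) (v : m.Vertex) (e : m.Edge) : Prop :=
  m.dist O v (m.terminus O e) = m.dist O v (m.origin O e) + 1

/-- The item `x` is an edge (and not a mark) that goes one step closer to `v`. -/
def IsCloser (O : Orientation) (v : m.Vertex) (x : m.Item) : Prop :=
  ∃ e, x = Sum.inl e ∧ m.dist O (m.terminus O e) v + 1 = m.dist O (m.origin O e) v

/-- The first edge going closer to `v` that is met while turning around a vertex in the direction
incoming edge, light face, the item `x` being the first one to be considered. -/
noncomputable def firstCloser (O : Orientation) (v : m.Vertex) (x : m.Item) : Option m.Edge :=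
  ((m.turnIn O ^ sInf {n : ℕ | m.IsCloser O v ((m.turnIn O ^ n) x)}) x).getLeft?

/-- The first `k` steps of the lightest geodesic towards `v` starting from the corner directly before
the item `x`. After an edge `e`, the turn around `e⁺` starts with the item following `e`. -/
noncomputable def geodesicSteps (O : Orientation) (v : m.Vertex) : ℕ → m.Item → List m.Edge
  | 0, _ => []
  | k + 1, x =>
    match m.firstCloser O v x with
    | none => []
    | some e => e :: geodesicSteps O v k (m.contourIn O (Sum.inl e))

/-- The lightest geodesic to the vertex `v` starting from the corner directly before the item `x`, in the
orientation `O`. -/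
noncomputable def lightestGeodesic (O : Orientation) (x : m.Item) (v : m.Vertex) : List m.Edge :=
  m.geodesicSteps O v (m.dist O (m.cornerVertex (m.cornerBefore O x)) v) x

/-- The edge `e` is incident to the light face with mark `i`. -/
def EdgeInFace (i : Fin r) (e : m.Edge) : Prop :=
  m.contour.SameCycle (Sum.inr i) (Sum.inl e)

/-- The corner `c` belongs to the light face with mark `i`. -/
def CornerInFace (i : Fin r) (c : m.Corner) : Prop :=
  m.contour.SameCycle (Sum.inr i) c

/-- The dark faces. -/
def DarkFace : Type := Quotient (Perm.SameCycle.setoid m.dark)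

/-- The map is a plane `p`-hypermap with exactly `r` light faces, numbered by `Fin r`, each of them
bearing one marked corner: light faces bear exactly one mark and are incident to at least one edge,
dark faces have degree `p`, the graph is connected, and the surface is a sphere. -/
structure IsHypermap (p : ℕ) : Prop where
  existsUnique_mark : ∀ x : m.Item, ∃! i : Fin r, m.contour.SameCycle (Sum.inr i) x
  contour_mark_ne : ∀ i : Fin r, m.contour (Sum.inr i) ≠ Sum.inr i
  dark_degree : ∀ e : m.Edge, Nat.card {e' : m.Edge // m.dark.SameCycle e e'} = p
  connected : ∀ v w : m.Vertex, Relation.EqvGen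
    (fun x y => ∃ e, m.origin .lightLeft e = x ∧ m.terminus .lightLeft e = y) v w
  euler : Nat.card m.Vertex + (r + Nat.card m.DarkFace) = Nat.card m.Edge + 2

/-- The light faces have respective degrees `a 0, …, a (r - 1)`. -/
def HasType (a : Fin r → ℕ) : Prop :=
  ∀ i, Nat.card {e : m.Edge // m.EdgeInFace i e} = a i

end MapData

/-- A map with a distinguished corner (in a light face) and a distinguished edge. -/
structure Pointed (r : ℕ) where
  /-- the map -/
  map : MapData r
  /-- the distinguished corner -/
  corner : map.Corner
  /-- the distinguished edge -/
  edge : map.Edge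

/-- Isomorphism of maps with distinguished elements, that is, orientation-preserving homeomorphism
preserving the shades of the faces, their numbers, the marks, and the distinguished elements. -/
def Pointed.Iso {r : ℕ} (s t : Pointed r) : Prop :=
  ∃ f : s.map.Edge ≃ t.map.Edge,
    (∀ x, t.map.contour (Sum.map f id x) = Sum.map f id (s.map.contour x)) ∧
    (∀ e, t.map.dark (f e) = f (s.map.dark e)) ∧
    t.corner = Sum.map f id s.corner ∧ t.edge = f s.edge

theorem Pointed.Iso.refl {r : ℕ} (s : Pointed r) : s.Iso s :=
  ⟨Equiv.refl _, by simp, by simp, by simp, by simp⟩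

theorem Pointed.Iso.symm {r : ℕ} {s t : Pointed r} (h : s.Iso t) : t.Iso s := by
  obtain ⟨f, h1, h2, h3, h4⟩ := h
  have hf : ∀ x, Sum.map f (id : Fin r → Fin r) (Sum.map f.symm id x) = x := by
    intro x; simp
  have hf' : ∀ x, Sum.map f.symm (id : Fin r → Fin r) (Sum.map f id x) = x := by
    intro x; simp
  refine ⟨f.symm, fun x => ?_, fun e => ?_, ?_, ?_⟩
  · rw [← hf' (s.map.contour _), ← h1, hf]
  · rw [Equiv.eq_symm_apply, ← h2, Equiv.apply_symm_apply]
  · rw [h3, hf']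
  · rw [h4, Equiv.symm_apply_apply]

theorem Pointed.Iso.trans {r : ℕ} {s t u : Pointed r} (h : s.Iso t) (h' : t.Iso u) : s.Iso u := by
  obtain ⟨f, h1, h2, h3, h4⟩ := h
  obtain ⟨g, k1, k2, k3, k4⟩ := h'
  have hc : ∀ x, Sum.map (f.trans g) (id : Fin r → Fin r) x = Sum.map g id (Sum.map f id x) := by
    intro x; cases x <;> simp
  refine ⟨f.trans g, fun x => ?_, fun e => ?_, ?_, ?_⟩
  · rw [hc, hc, k1, h1]
  · simp [k2, h2]
  · rw [hc, k3, h3]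
  · simp [k4, h4]

instance Pointed.setoid (r : ℕ) : Setoid (Pointed r) where
  r := Pointed.Iso
  iseqv := ⟨Pointed.Iso.refl, Pointed.Iso.symm, Pointed.Iso.trans⟩

namespace Pointed

variable {r : ℕ} (O : Orientation) (t : Pointed r)

/-- The sliding path: the lightest geodesic, in the orientation `O`, from the corner preceding the
distinguished edge to the vertex incident to the distinguished corner. If the distinguished edge is
leaving that vertex in the reverse of `O`, then it is the first edge of this path. -/
noncomputable def slidingPath : List t.map.Edge :=
  t.map.lightestGeodesic O (Sum.inl t.edge) (t.map.cornerVertex t.corner)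

open Classical in
/-- The contours after the light side of the distinguished edge has been removed from the contour of its
face (it becomes a fixed point of the permutation). -/
noncomputable def removed : Perm t.map.Item :=
  Equiv.swap (Sum.inl t.edge) (t.map.contourIn O (Sum.inl t.edge)) * t.map.contourIn O

open Classical in
/-- The contours after a new light side, under the name of the distinguished edge, has furthermore been
inserted at the distinguished corner, that is, directly before the item following that corner. -/
noncomputable def inserted : Perm t.map.Item :=
  t.removed O * Equiv.swap ((t.removed O)⁻¹ (t.map.itemAfter O t.corner)) (Sum.inl t.edge)

open Classical in
/-- The matching of light sides with dark sides: along the sliding path `(e₁, …, e_k)`, the light side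
of `e_{i+1}` is matched with the dark side of `e_i` for `1 ≤ i < k`, and the new light side,
which bears the name `e₁`, is matched with the dark side of `e_k`. -/
noncomputable def rename : Perm t.map.Item :=
  Perm.sumCongr (t.slidingPath O).formPerm⁻¹ 1

/-- The contours in the new map, in the orientation `O`, each edge bearing the name of its dark side. -/
noncomputable def slidContour : Perm t.map.Item :=
  t.rename O * t.inserted O * (t.rename O)⁻¹

/-- The map obtained by slitting, sliding, and sewing along the sliding path, and then removing the
dangling edge. The edges bear the names of their dark sides, so that the dark faces do not change. -/
noncomputable def slidMap : MapData r where
  Edge := t.map.Edge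
  finite := t.map.finite
  contour := match O with
    | .lightLeft => t.slidContour .lightLeft
    | .lightRight => (t.slidContour .lightRight)⁻¹
  dark := t.map.dark

end Pointed

/-- The slit-slide-sew operation, in the orientation `O`, along the sliding path, from the corner preceding
the distinguished edge to the distinguished corner. The new distinguished corner is the one left by the
removed light side of the first edge of the path: it follows the item that preceded this light side. The new
distinguished edge is the one given by the dark side of the last edge of the path. -/
noncomputable def slide {r : ℕ} (O : Orientation) (t : Pointed r) : Pointed r where
  map := t.slidMap O
  corner := (t.slidMap O).cornerAfter O
    (t.rename O ((t.map.contourIn O)⁻¹ (Sum.inl t.edge)))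
  edge := (t.slidingPath O).getLast?.getD t.edge

namespace MapData

variable {r : ℕ}

/-- Isomorphism of maps. -/
structure MapIso (m m' : MapData r) where
  /-- the bijection between edges -/
  f : m.Edge ≃ m'.Edge
  contour_map : ∀ x, m'.contour (Sum.map f id x) = Sum.map f id (m.contour x)
  dark_map : ∀ e, m'.dark (f e) = f (m.dark e)

namespace MapIso

variable {m m' : MapData r} (F : MapIso m m')

/-- The induced bijection between items. -/
def onItem : m.Item ≃ m'.Item := Equiv.sumCongr F.f (Equiv.refl _)

theorem onItem_eq (x : m.Item) : F.onItem x = Sum.map F.f id x := by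
  cases x <;> rfl

@[simp] theorem onItem_inl (e : m.Edge) : F.onItem (Sum.inl e) = Sum.inl (F.f e) := rfl

@[simp] theorem onItem_inr (i : Fin r) : F.onItem (Sum.inr i) = Sum.inr i := rfl

theorem contour_onItem (x : m.Item) : m'.contour (F.onItem x) = F.onItem (m.contour x) := by
  simp only [onItem_eq, F.contour_map]

/-- The inverse isomorphism. -/
def symm : MapIso m' m where
  f := F.f.symm
  contour_map x := by
    have h := F.contour_onItem (F.onItem.symm x)
    rw [Equiv.apply_symm_apply] at h
    have h2 : ∀ y, Sum.map F.f.symm id y = F.onItem.symm y := by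
      intro y; cases y <;> rfl
    rw [h2, h2, h, Equiv.symm_apply_apply]
  dark_map e := by
    rw [Equiv.eq_symm_apply, ← F.dark_map, Equiv.apply_symm_apply]

theorem perm_inv {α β : Type} (g : α ≃ β) (p : Perm α) (q : Perm β)
    (h : ∀ x, q (g x) = g (p x)) (x : α) : q⁻¹ (g x) = g (p⁻¹ x) := by
  rw [Perm.inv_eq_iff_eq, h]
  exact congrArg g (p.apply_symm_apply x).symm

theorem perm_pow {α β : Type} (g : α ≃ β) (p : Perm α) (q : Perm β)
    (h : ∀ x, q (g x) = g (p x)) (n : ℕ) (x : α) : (q ^ n) (g x) = g ((p ^ n) x) := by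
  induction n generalizing x with
  | zero => rfl
  | succ n ih => rw [pow_succ, pow_succ, Perm.mul_apply, Perm.mul_apply, h, ih]

theorem perm_zpow {α β : Type} (g : α ≃ β) (p : Perm α) (q : Perm β)
    (h : ∀ x, q (g x) = g (p x)) (n : ℤ) (x : α) : (q ^ n) (g x) = g ((p ^ n) x) := by
  cases n with
  | ofNat n => exact perm_pow g p q h n x
  | negSucc n =>
    rw [zpow_negSucc, zpow_negSucc]
    exact perm_inv g _ _ (perm_pow g p q h (n + 1)) x

theorem contourIn_map (O : Orientation) (x : m.Item) :
    m'.contourIn O (F.onItem x) = F.onItem (m.contourIn O x) := by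
  cases O
  · exact F.contour_onItem x
  · exact perm_inv F.onItem _ _ F.contour_onItem x

theorem darkIn_map (O : Orientation) (e : m.Edge) :
    m'.darkIn O (F.f e) = F.f (m.darkIn O e) := by
  cases O
  · exact F.dark_map e
  · exact perm_inv F.f _ _ F.dark_map e

theorem turnIn_map (O : Orientation) (x : m.Item) :
    m'.turnIn O (F.onItem x) = F.onItem (m.turnIn O x) := by
  simp only [turnIn, Perm.mul_apply]
  rw [← F.contourIn_map]
  congr 1
  cases x with
  | inl e =>
    exact congrArg Sum.inl (perm_inv F.f _ _ (F.darkIn_map O) e)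
  | inr i => rfl

theorem cornerBefore_map (O : Orientation) (x : m.Item) :
    m'.cornerBefore O (F.onItem x) = F.onItem (m.cornerBefore O x) := by
  cases O
  · rfl
  · exact F.contour_onItem x

theorem cornerAfter_map (O : Orientation) (x : m.Item) :
    m'.cornerAfter O (F.onItem x) = F.onItem (m.cornerAfter O x) := by
  cases O
  · exact F.contour_onItem x
  · rfl

theorem itemAfter_map (O : Orientation) (c : m.Corner) :
    m'.itemAfter O (F.onItem c) = F.onItem (m.itemAfter O c) := by
  cases O
  · rfl
  · exact perm_inv F.onItem _ _ F.contour_onItem c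

/-- The induced map between vertices. -/
def onVertex : m.Vertex → m'.Vertex :=
  Quotient.map' F.onItem (by
    rintro x y ⟨n, rfl⟩
    exact ⟨n, perm_zpow F.onItem _ _ (F.turnIn_map .lightLeft) n x⟩)

theorem cornerVertex_map (c : m.Corner) :
    m'.cornerVertex (F.onItem c) = F.onVertex (m.cornerVertex c) := rfl

theorem onVertex_symm (v : m.Vertex) : F.symm.onVertex (F.onVertex v) = v := by
  refine Quotient.inductionOn' v fun c => ?_
  change m.cornerVertex (F.symm.onItem (F.onItem c)) = m.cornerVertex c
  congr 1
  exact F.onItem.symm_apply_apply c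

theorem origin_map (O : Orientation) (e : m.Edge) :
    m'.origin O (F.f e) = F.onVertex (m.origin O e) := by
  rw [origin, ← onItem_inl, cornerBefore_map, cornerVertex_map]
  rfl

theorem terminus_map (O : Orientation) (e : m.Edge) :
    m'.terminus O (F.f e) = F.onVertex (m.terminus O e) := by
  rw [terminus, ← onItem_inl, cornerAfter_map, cornerVertex_map]
  rfl

theorem isPath_map (O : Orientation) (v w : m.Vertex) (l : List m.Edge)
    (h : m.IsPath O v w l) : m'.IsPath O (F.onVertex v) (F.onVertex w) (l.map F.f) := by
  induction l generalizing v with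
  | nil => exact congrArg F.onVertex h
  | cons e l ih =>
    refine ⟨(F.origin_map O e).trans (congrArg F.onVertex h.1), ?_⟩
    rw [terminus_map]
    exact ih _ h.2

theorem dist_map (O : Orientation) (v w : m.Vertex) :
    m'.dist O (F.onVertex v) (F.onVertex w) = m.dist O v w := by
  unfold dist
  congr 1
  ext k
  constructor
  · rintro ⟨l, hl, rfl⟩
    have h := F.symm.isPath_map O _ _ l hl
    rw [onVertex_symm, onVertex_symm] at h
    exact ⟨_, h, List.length_map _⟩
  · rintro ⟨l, hl, rfl⟩
    exact ⟨_, F.isPath_map O _ _ l hl, List.length_map _⟩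

theorem isCloser_map (O : Orientation) (v : m.Vertex) (x : m.Item) :
    m'.IsCloser O (F.onVertex v) (F.onItem x) ↔ m.IsCloser O v x := by
  cases x with
  | inl e => simp [IsCloser, terminus_map, origin_map, dist_map]
  | inr i => simp [IsCloser]

theorem firstCloser_map (O : Orientation) (v : m.Vertex) (x : m.Item) :
    m'.firstCloser O (F.onVertex v) (F.onItem x) = (m.firstCloser O v x).map F.f := by
  unfold firstCloser
  simp only [perm_pow F.onItem _ _ (F.turnIn_map O), isCloser_map]
  generalize (m.turnIn O ^ _) x = y
  cases y <;> simp

theorem geodesicSteps_map (O : Orientation) (v : m.Vertex) (k : ℕ) (x : m.Item) :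
    m'.geodesicSteps O (F.onVertex v) k (F.onItem x) = (m.geodesicSteps O v k x).map F.f := by
  induction k generalizing x with
  | zero => rfl
  | succ k ih =>
    simp only [geodesicSteps, firstCloser_map]
    cases m.firstCloser O v x with
    | none => rfl
    | some e =>
      simp only [Option.map_some, List.map_cons]
      rw [← ih, ← contourIn_map, onItem_inl]

theorem lightestGeodesic_map (O : Orientation) (x : m.Item) (v : m.Vertex) :
    m'.lightestGeodesic O (F.onItem x) (F.onVertex v) = (m.lightestGeodesic O x v).map F.f := by
  unfold lightestGeodesic
  rw [cornerBefore_map, cornerVertex_map, dist_map, geodesicSteps_map]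

end MapIso

theorem swap_map {α β : Type} [DecidableEq α] [DecidableEq β] (g : α ≃ β) (a b x : α) :
    Equiv.swap (g a) (g b) (g x) = g (Equiv.swap a b x) := by
  simp only [Equiv.swap_apply_def, g.injective.eq_iff, apply_ite g]

theorem formPerm_map {α β : Type} [DecidableEq α] [DecidableEq β] (g : α ≃ β) (l : List α)
    (x : α) : (l.map g).formPerm (g x) = g (l.formPerm x) := by
  induction l generalizing x with
  | nil => rfl
  | cons a l ih =>
    cases l with
    | nil => rfl
    | cons b l =>
      rw [List.map_cons, List.map_cons, List.formPerm_cons_cons, List.formPerm_cons_cons,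
        Perm.mul_apply, Perm.mul_apply, ← List.map_cons, ih, swap_map]

end MapData

open Classical in
theorem slide_iso {r : ℕ} (O : Orientation) {s t : Pointed r} (h : s.Iso t) :
    (slide O s).Iso (slide O t) := by
  obtain ⟨f, h1, h2, h3, h4⟩ := h
  obtain ⟨m, c, e⟩ := s
  obtain ⟨m', c', e'⟩ := t
  change m.Edge ≃ m'.Edge at f
  change ∀ x, m'.contour (Sum.map f id x) = Sum.map f id (m.contour x) at h1
  change ∀ e, m'.dark (f e) = f (m.dark e) at h2
  have h3' : c' = (⟨f, h1, h2⟩ : MapData.MapIso m m').onItem c :=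
    h3.trans (MapData.MapIso.onItem_eq (⟨f, h1, h2⟩ : MapData.MapIso m m') c).symm
  have h4' : e' = f e := h4
  clear h3 h4
  subst h3' h4'
  let F : MapData.MapIso m m' := ⟨f, h1, h2⟩
  let s : Pointed r := ⟨m, c, e⟩
  let t : Pointed r := ⟨m', F.onItem c, F.f e⟩
  have hγ : t.slidingPath O = (s.slidingPath O).map F.f :=
    F.lightestGeodesic_map O (Sum.inl e) (m.cornerVertex c)
  have hren : ∀ x : m.Item, t.rename O (F.onItem x) = F.onItem (s.rename O x) := by
    intro x
    unfold Pointed.rename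
    rw [hγ]
    cases x with
    | inl y =>
      exact congrArg Sum.inl
        (MapData.MapIso.perm_inv F.f _ _ (MapData.formPerm_map F.f (s.slidingPath O)) y)
    | inr i => rfl
  have hκ := F.contourIn_map O
  have hrem : ∀ x : m.Item, t.removed O (F.onItem x) = F.onItem (s.removed O x) := by
    intro x
    simp only [Pointed.removed, Perm.mul_apply]
    rw [hκ, ← MapData.MapIso.onItem_inl, hκ, MapData.swap_map]
  have hins : ∀ x : m.Item, t.inserted O (F.onItem x) = F.onItem (s.inserted O x) := by
    intro x
    simp only [Pointed.inserted, Perm.mul_apply]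
    have h5 : m'.itemAfter O t.corner = F.onItem (m.itemAfter O s.corner) :=
      F.itemAfter_map O c
    rw [h5, MapData.MapIso.perm_inv F.onItem _ _ hrem, ← MapData.MapIso.onItem_inl,
      MapData.swap_map, hrem]
  have hnew : ∀ x : m.Item, t.slidContour O (F.onItem x) = F.onItem (s.slidContour O x) := by
    intro x
    simp only [Pointed.slidContour, Perm.mul_apply]
    rw [MapData.MapIso.perm_inv F.onItem _ _ hren, hins, hren]
  have hcont : ∀ x : m.Item,
      (t.slidMap O).contour (F.onItem x) = F.onItem ((s.slidMap O).contour x) := by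
    intro x
    cases O
    · exact hnew x
    · exact MapData.MapIso.perm_inv F.onItem _ _ hnew x
  let G : MapData.MapIso (s.slidMap O) (t.slidMap O) :=
    ⟨f, fun x => by
      have h := hcont x
      have h7 := F.onItem_eq ((s.slidMap O).contour x)
      have h8 := F.onItem_eq x
      exact (congrArg (t.slidMap O).contour h8).symm.trans (h.trans h7), h2⟩
  refine ⟨f, G.contour_map, h2, ?_, ?_⟩
  · have h6 : t.rename O ((m'.contourIn O)⁻¹ (Sum.inl (F.f e))) =
        F.onItem (s.rename O ((m.contourIn O)⁻¹ (Sum.inl e))) := by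
      rw [← MapData.MapIso.onItem_inl, MapData.MapIso.perm_inv F.onItem _ _ hκ, hren]
    change (t.slidMap O).cornerAfter O (t.rename O ((m'.contourIn O)⁻¹ (Sum.inl (F.f e)))) = _
    rw [h6]
    exact (G.cornerAfter_map O _).trans (G.onItem_eq _)
  · change (t.slidingPath O).getLast?.getD (F.f e) = F.f ((s.slidingPath O).getLast?.getD e)
    rw [hγ, List.getLast?_map]
    cases (s.slidingPath O).getLast? <;> rfl

/-- Maps with a distinguished corner and a distinguished edge, up to isomorphism. -/
def PointedClass (r : ℕ) : Type 1 := Quotient (Pointed.setoid r)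

/-- The mapping `Φ` on quadruples (orientation, map, distinguished corner, distinguished edge): the
orientation is reversed, and the slit-slide-sew operation is done in the reversed orientation. -/
noncomputable def Phi {r : ℕ} (q : Orientation × PointedClass r) : Orientation × PointedClass r :=
  (q.1.reverse, Quotient.map (slide q.1.reverse) (fun _ _ h => slide_iso q.1.reverse h) q.2)

/-- The set of plane `p`-hypermaps of type `a` carrying one distinguished corner `c` in the face
`cornerFace` and one distinguished edge `e` incident to the face `edgeFace` and leaving `c⁺`, in the orientation `O`, up to isomorphism. -/
def pointedHypermaps {r : ℕ} (p : ℕ) (a : Fin r → ℕ) (O : Orientation) (cornerFace edgeFace : Fin r) :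
    Set (PointedClass r) :=
  Quotient.mk (Pointed.setoid r) ''
    {t | t.map.IsHypermap p ∧ t.map.HasType a ∧ t.map.CornerInFace cornerFace t.corner ∧
      t.map.EdgeInFace edgeFace t.edge ∧ t.map.IsLeaving O (t.map.cornerVertex t.corner) t.edge}

/-- Transferring one degree from the first face to the second face. -/
def transfer {r : ℕ} (a : Fin (r + 2) → ℕ) : Fin (r + 2) → ℕ :=
  Function.update (Function.update a 0 (a 0 - 1)) 1 (a 1 + 1)

end Hypermap

/-! The operation is undone by the same operation in the opposite orientation, and the conditions on
source and target are exchanged, so the bijection follows from `Pointed.Slidable.slide_slide` and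
`Pointed.IsPointedHypermap.slide`.

On permutations, the light side of the distinguished edge is taken out of its contour and put back
at the distinguished corner (`reinsert`), and the result is conjugated by the cyclic shift along the
sliding path. Both moves are plainly invertible (`reinsert_reinsert`), provided that the backward
operation uses the same path. The heart of the proof is therefore that the reversed path is the
lightest geodesic of the new map in the reverse orientation.

For this, the distance to the end of the path is transported to the new map. The items swept on the
light side of the slit between `e i` and `e (i + 1)` now lie at the vertex where `e i` starts, so
their level goes up by one (`SlitSlide.slid`, `SlitSlide.slid_turn`). As the path is lightest, none
of these items goes closer to the end. Hence the corrected level still drops by at most one along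
each new edge (`SlitSlide.slid_level_le`), which bounds the new distances from below and makes the
reversed path geodesic. It does not drop at all along the relevant edges arriving at the light side
(`SlitSlide.slid_level_strict`), so no competing edge is met before the next edge of the reversed
path (`SlitSlide.exists_reverse_turn`).

The sphere is preserved by a count. Transporting the identity of old vertices gives a surjection
from new vertices onto old ones; the inverse operation gives the opposite inequality. Edges and dark
faces are unchanged and the number of light faces stays `r`, so Euler's relation persists.
Connectivity passes through because predicates invariant in the new map are invariant in the old
one. -/

namespace Hypermap

/-! ### Local rules of the operation and transport of vertex functions -/

/-- The local rules of the slit-slide-sew operation, read on the items of the contours. The contours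
are given by `κ`, the items around a vertex by `κ * D`, and the new contours by `κ'`. The path is
`e 0, …, e (k - 1)`, and `e k` is the item after the corner through which the slit exits. One has to turn
`n i` times after `e i` to meet `e (i + 1)`. The function `h` is the distance to the end of the path. -/
structure SlitSlide {X : Type} (κ D κ' : Perm X) (s : X → X) (k : ℕ) (e : ℕ → X) (n : ℕ → ℕ)
    (h : X → ℕ) : Prop where
  pos : 0 < k
  level_turn : ∀ x, h (κ (D x)) = h x
  level_le : ∀ x, h x ≤ h (κ x) + 1
  level_path : ∀ i ≤ k, h (e i) + i = k
  hit : ∀ i < k, ((κ * D) ^ n i) (κ (e i)) = e (i + 1)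
  hit_min : ∀ i < k, ∀ m < n i, ((κ * D) ^ m) (κ (e i)) ≠ e (i + 1)
  light : ∀ i < k, ∀ m < n i,
    h (((κ * D) ^ m) (κ (e i))) ≤ h (κ (((κ * D) ^ m) (κ (e i))))
  shift_path : ∀ j < k, s (e (j + 1)) = e j
  shift_other : ∀ y, (∀ j ≤ k, y ≠ e j) → s y = y
  new_path : ∀ i, i + 1 < k → κ' (e i) = s (κ (e (i + 1)))
  new_last : ∀ i, i + 1 = k → κ' (e i) = e k
  new_first : ∀ y, (∀ i < k, y ≠ e i) → κ y = e 0 → κ' y = s (κ (e 0))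
  new_other : ∀ y, (∀ i < k, y ≠ e i) → κ y ≠ e 0 → κ' y = s (κ y)

theorem inv_apply_apply {X : Type} (f : Perm X) (x : X) : f⁻¹ (f x) = x := f.symm_apply_apply x

theorem apply_inv_apply {X : Type} (f : Perm X) (x : X) : f (f⁻¹ x) = x := f.apply_symm_apply x

theorem pow_apply_invariant {X V : Type} {f : Perm X} {u : X → V} (hu : ∀ x, u (f x) = u x)
    (m : ℕ) (x : X) : u ((f ^ m) x) = u x := by
  induction m with
  | zero => rfl
  | succ m ih => rw [pow_succ', Perm.mul_apply, hu, ih]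

namespace SlitSlide

variable {X V : Type} {κ D κ' : Perm X} {s : X → X} {k : ℕ} {e : ℕ → X} {n : ℕ → ℕ} {h : X → ℕ}

/-- The items on the light side of the slit, between `e i` and `e (i + 1)`. -/
def Left (κ D : Perm X) (e : ℕ → X) (n : ℕ → ℕ) (i : ℕ) (x : X) : Prop :=
  ∃ m < n i, x = ((κ * D) ^ m) (κ (e i))

open Classical in
/-- The value of a function of the old vertices at a new vertex: the items on the light side of the slit
are now around the same vertex as the preceding edge of the path. -/
noncomputable def slid (κ D : Perm X) (k : ℕ) (e : ℕ → X) (n : ℕ → ℕ) (u : X → V) (x : X) : V :=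
  if H : ∃ i < k, Left κ D e n i x then u (e H.choose) else u x

variable (S : SlitSlide κ D κ' s k e n h)

include S

theorem level_pow (m : ℕ) (x : X) : h (((κ * D) ^ m) x) = h x :=
  pow_apply_invariant (f := κ * D) S.level_turn m x

theorem level_next {i : ℕ} (hi : i < k) : h (κ (e i)) + (i + 1) = k := by
  rw [← S.level_path (i + 1) hi, ← S.hit i hi, S.level_pow]

theorem level_left {i : ℕ} (hi : i < k) {x : X} (hx : Left κ D e n i x) : h x + (i + 1) = k := by
  obtain ⟨m, -, rfl⟩ := hx
  rw [S.level_pow, S.level_next hi]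

/-- Levels leave `e (i + 1)` as the only candidate, and the minimality of `n i` excludes it. -/
theorem left_ne {i : ℕ} (hi : i < k) {x : X} (hx : Left κ D e n i x) {j : ℕ} (hj : j ≤ k) :
    x ≠ e j := by
  intro hxj
  have h1 := S.level_left hi hx
  have h2 := S.level_path j hj
  rw [hxj] at h1
  have : j = i + 1 := by omega
  subst this
  obtain ⟨m, hm, rfl⟩ := hx
  exact S.hit_min i hi m hm hxj

theorem left_unique {i j : ℕ} (hi : i < k) (hj : j < k) {x : X} (hx : Left κ D e n i x)
    (hx' : Left κ D e n j x) : i = j := by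
  have h1 := S.level_left hi hx
  have h2 := S.level_left hj hx'
  omega

theorem left_turn {i : ℕ} (hi : i < k) {x : X} (hx : Left κ D e n i x) :
    κ (D x) = e (i + 1) ∨ Left κ D e n i (κ (D x)) := by
  obtain ⟨m, hm, rfl⟩ := hx
  have h1 : κ (D (((κ * D) ^ m) (κ (e i)))) = ((κ * D) ^ (m + 1)) (κ (e i)) := by
    rw [pow_succ']; rfl
  rw [h1]
  rcases Nat.lt_or_ge (m + 1) (n i) with hlt | hge
  · exact Or.inr ⟨m + 1, hlt, rfl⟩
  · have : m + 1 = n i := by omega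
    rw [this]
    exact Or.inl (S.hit i hi)

omit S in
theorem left_of_turn {i : ℕ} {x : X} (hx : Left κ D e n i (κ (D x))) (hD : D x ≠ e i) :
    Left κ D e n i x := by
  obtain ⟨m, hm, hx⟩ := hx
  cases m with
  | zero => exact absurd (κ.injective hx) hD
  | succ m =>
    rw [pow_succ'] at hx
    exact ⟨m, by omega, (κ * D).injective hx⟩

theorem left_of_turn_eq {i : ℕ} (hi : i < k) {x : X} (hx : κ (D x) = e (i + 1))
    (hD : D x ≠ e i) : Left κ D e n i x := by
  have h1 := S.hit i hi
  rw [← hx] at h1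
  cases hn : n i with
  | zero =>
    rw [hn] at h1
    exact absurd (κ.injective h1).symm hD
  | succ m =>
    rw [hn, pow_succ'] at h1
    exact ⟨m, by omega, ((κ * D).injective h1).symm⟩

theorem turn_pow_ne {i : ℕ} (hi : i < k) {m : ℕ} (hm : m < n i) :
    ((κ * D) ^ (m + 1)) (κ (e i)) ≠ κ (e i) := by
  intro h1
  have h2 := S.hit i hi
  have h3 : n i = (n i - (m + 1)) + (m + 1) := by omega
  rw [h3, pow_add, Perm.mul_apply, h1] at h2
  exact S.hit_min i hi _ (by omega) h2

/-- One more turn from such an `x` leads to `κ (e i)`. If `x` were on the light side, the turn would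
return to its starting item before meeting `e (i + 1)`, and so would have met it earlier than `n i`.
-/
theorem not_left {i j : ℕ} (hi : i < k) (hj : j < k) {x : X} (hD : D x = e i) :
    ¬ Left κ D e n j x := by
  intro hx
  have h1 := S.level_left hj hx
  have h2 := S.level_next hi
  rw [← S.level_turn, hD] at h1
  have : i = j := by omega
  subst this
  obtain ⟨m, hm, rfl⟩ := hx
  refine S.turn_pow_ne hi hm ?_
  rw [pow_succ', Perm.mul_apply, Perm.mul_apply, hD]

theorem slid_left (u : X → V) {i : ℕ} (hi : i < k) {x : X} (hx : Left κ D e n i x) :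
    slid κ D k e n u x = u (e i) := by
  have H : ∃ i < k, Left κ D e n i x := ⟨i, hi, hx⟩
  rw [slid, dif_pos H, S.left_unique H.choose_spec.1 hi H.choose_spec.2 hx]

omit S in
theorem slid_of_not_left (u : X → V) {x : X} (hx : ∀ i < k, ¬ Left κ D e n i x) :
    slid κ D k e n u x = u x := by
  have H : ¬ ∃ i < k, Left κ D e n i x := by
    rintro ⟨i, hi, h1⟩; exact hx i hi h1
  rw [slid, dif_neg H]

theorem slid_path (u : X → V) {i : ℕ} (hi : i ≤ k) : slid κ D k e n u (e i) = u (e i) :=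
  slid_of_not_left u fun _ hj hx => S.left_ne hj hx hi rfl

theorem shift_left {i : ℕ} (hi : i < k) {x : X} (hx : Left κ D e n i x) : s x = x :=
  S.shift_other x fun _ hj => S.left_ne hi hx hj

/-- This is the slide by one step. The item concerned is either `e (i + 1)`, renamed `e i`, when
nothing lies between the two edges, or the first item on the light side. -/
theorem slid_shift_next (u : X → V) {i : ℕ} (hi : i < k) :
    slid κ D k e n u (s (κ (e i))) = u (e i) := by
  rcases Nat.eq_zero_or_pos (n i) with h0 | hpos
  · have h1 := S.hit i hi
    rw [h0] at h1
    rw [show κ (e i) = e (i + 1) from h1, S.shift_path i hi, S.slid_path u hi.le]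
  · have hx : Left κ D e n i (κ (e i)) := ⟨0, hpos, rfl⟩
    rw [S.shift_left hi hx, S.slid_left u hi hx]

/-- The functions of the old vertices induce functions of the new vertices. -/
theorem slid_turn {u : X → V} (hu : ∀ x, u (κ (D x)) = u x) (x : X) :
    slid κ D k e n u (κ' (D x)) = slid κ D k e n u x := by
  have hnext : ∀ i < k, u (κ (e i)) = u (e (i + 1)) := fun i hi => by
    rw [← S.hit i hi, pow_apply_invariant (f := κ * D) hu]
  by_cases hD : ∃ i < k, D x = e i
  · obtain ⟨i, hi, hD⟩ := hD
    -- Here the turn in the old map crosses the slit just after `e i`. The item `x` stays at the end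
    -- of `e i`, and the sewing makes the next new item one that lies at the start of `e (i + 1)`.
    have hx : slid κ D k e n u x = u (e (i + 1)) := by
      rw [slid_of_not_left u fun j hj => S.not_left hi hj hD, ← hu, hD, hnext i hi]
    rw [hx, hD]
    rcases Nat.lt_or_ge (i + 1) k with hlt | hge
    · rw [S.new_path i hlt, S.slid_shift_next u hlt]
    · have : i + 1 = k := by omega
      rw [S.new_last i this, S.slid_path u le_rfl, this]
  · push Not at hD
    by_cases h0 : κ (D x) = e 0
    · rw [S.new_first _ hD h0, S.slid_shift_next u S.pos, slid_of_not_left, ← hu x, h0]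
      intro i hi hx
      have h1 := S.level_left hi hx
      have h2 := S.level_path 0 (by omega)
      rw [← S.level_turn, h0] at h1
      omega
    · rw [S.new_other _ hD h0]
      by_cases hp : ∃ j < k, κ (D x) = e (j + 1)
      · obtain ⟨j, hj, hp⟩ := hp
        rw [hp, S.shift_path j hj, S.slid_path u hj.le,
          S.slid_left u hj (S.left_of_turn_eq hj hp (hD j hj))]
      · push Not at hp
        rw [S.shift_other]
        · by_cases hl : ∃ i < k, Left κ D e n i x
          · obtain ⟨i, hi, hl⟩ := hl
            rw [S.slid_left u hi hl,
              S.slid_left u hi ((S.left_turn hi hl).resolve_left (hp i hi))]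
          · push Not at hl
            rw [slid_of_not_left u hl, slid_of_not_left, hu]
            intro i hi hx
            exact hl i hi (left_of_turn hx (hD i hi))
        · intro j hj
          cases j with
          | zero => exact h0
          | succ j => exact hp j hj

/-- Only light side items change value, and the value lost by those after `e i` is still taken at `e
(i + 1)`. -/
theorem slid_surjective {u : X → V} (hu : ∀ x, u (κ (D x)) = u x) (x : X) :
    ∃ y, slid κ D k e n u y = u x := by
  by_cases hl : ∃ i < k, Left κ D e n i x
  · obtain ⟨i, hi, m, -, rfl⟩ := hl
    refine ⟨e (i + 1), ?_⟩
    rw [S.slid_path u hi, ← S.hit i hi, pow_apply_invariant (f := κ * D) hu,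
      pow_apply_invariant (f := κ * D) hu]
  · push Not at hl
    exact ⟨x, slid_of_not_left u hl⟩

theorem slid_level_path {i : ℕ} (hi : i ≤ k) : slid κ D k e n h (e i) + i = k := by
  rw [S.slid_path h hi, S.level_path i hi]

theorem slid_level_left {i : ℕ} (hi : i < k) {x : X} (hx : Left κ D e n i x) :
    slid κ D k e n h x + i = k := by
  rw [S.slid_left h hi hx, S.level_path i hi.le]

theorem level_le_slid (x : X) : h x ≤ slid κ D k e n h x := by
  by_cases hl : ∃ i < k, Left κ D e n i x
  · obtain ⟨i, hi, hl⟩ := hl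
    have h1 := S.slid_level_left hi hl
    have h2 := S.level_left hi hl
    omega
  · push Not at hl
    rw [slid_of_not_left h hl]

/-- The correction by one on the light side is absorbed by `light`: those items do not go closer to
the end. -/
theorem slid_le_level (x : X) : slid κ D k e n h x ≤ h (κ x) + 1 := by
  by_cases hl : ∃ i < k, Left κ D e n i x
  · obtain ⟨i, hi, hl⟩ := hl
    have h1 := S.slid_level_left hi hl
    have h2 := S.level_left hi hl
    obtain ⟨m, hm, rfl⟩ := hl
    have h3 := S.light i hi m hm
    omega
  · push Not at hl
    rw [slid_of_not_left h hl]
    exact S.level_le x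

/-- The new potential decreases at most by one along a new edge. -/
theorem slid_level_le (x : X) : slid κ D k e n h x ≤ slid κ D k e n h (κ' x) + 1 := by
  have hpos := S.pos
  by_cases hx : ∃ i < k, x = e i
  · obtain ⟨i, hi, rfl⟩ := hx
    have h1 := S.slid_level_path hi.le
    rcases Nat.lt_or_ge (i + 1) k with hlt | hge
    · rw [S.new_path i hlt, S.slid_shift_next h hlt]
      have h2 := S.level_path (i + 1) hlt.le
      omega
    · omega
  · push Not at hx
    have h1 := S.slid_le_level x
    by_cases h0 : κ x = e 0
    · rw [S.new_first x hx h0, S.slid_shift_next h hpos]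
      rwa [h0] at h1
    · rw [S.new_other x hx h0]
      by_cases hp : ∃ j < k, κ x = e (j + 1)
      · obtain ⟨j, hj, hp⟩ := hp
        rw [hp, S.shift_path j hj]
        have h2 := S.slid_level_path hj.le
        have h3 := S.level_path (j + 1) hj
        rw [hp] at h1
        omega
      · push Not at hp
        rw [S.shift_other]
        · exact h1.trans (Nat.add_le_add_right (S.level_le_slid _) 1)
        · intro j hj
          cases j with
          | zero => exact h0
          | succ j => exact hp j hj

/-- The new potential does not decrease along a new edge that arrives at the light side of the path. -/
theorem slid_level_strict {x : X} (hx : ∀ i < k, x ≠ e i) (h0 : κ x ≠ e 0) {i : ℕ} (hi : i < k)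
    (hl : κ' x = e i ∨ Left κ D e n i (κ' x)) :
    slid κ D k e n h x ≤ slid κ D k e n h (κ' x) := by
  have h1 := S.slid_le_level x
  have hκ := S.new_other x hx h0
  -- In both cases the corrected level on arrival exceeds `h (κ x)` by one: either the arrival is
  -- renamed from `e (j + 1)` to `e j`, or it is on the light side. This compensates the `+ 1` of
  -- `slid_le_level`.
  by_cases hp : ∃ j < k, κ x = e (j + 1)
  · obtain ⟨j, hj, hp⟩ := hp
    rw [hκ, hp, S.shift_path j hj]
    have h2 := S.slid_level_path hj.le
    have h3 := S.level_path (j + 1) hj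
    rw [hp] at h1
    omega
  · push Not at hp
    have hne : ∀ j ≤ k, κ x ≠ e j := by
      intro j hj
      cases j with
      | zero => exact h0
      | succ j => exact hp j hj
    rw [S.shift_other _ hne] at hκ
    rw [hκ] at hl ⊢
    have hl := hl.resolve_left (hne i hi.le)
    have h2 := S.slid_level_left hi hl
    have h3 := S.level_left hi hl
    omega

theorem new_turn_left {i : ℕ} (hi : i < k) {x : X} (hx : Left κ D e n i x) :
    κ' (D x) = s (κ (D x)) := by
  refine S.new_other _ (fun j hj hD => S.not_left hj hi hD hx) fun h0 => ?_
  have h1 := S.level_left hi hx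
  have h2 := S.level_path 0 (Nat.zero_le k)
  rw [← S.level_turn, h0] at h1
  omega

theorem new_turn_pow {i : ℕ} (hi : i < k) {m : ℕ} (hm : m ≤ n i) :
    ((κ' * D) ^ m) (s (κ (e i))) = s (((κ * D) ^ m) (κ (e i))) := by
  induction m with
  | zero => rfl
  | succ m ih =>
    have hl : Left κ D e n i (((κ * D) ^ m) (κ (e i))) := ⟨m, by omega, rfl⟩
    rw [pow_succ', Perm.mul_apply, ih (by omega), S.shift_left hi hl, Perm.mul_apply,
      S.new_turn_left hi hl, pow_succ', Perm.mul_apply, Perm.mul_apply]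

/-- In the new map, one turns from the item following `e i` on the contour in the old map to `e i`. -/
theorem new_turn_hit {i : ℕ} (hi : i < k) : ((κ' * D) ^ n i) (s (κ (e i))) = e i := by
  rw [S.new_turn_pow hi le_rfl, S.hit i hi, S.shift_path i hi]

/-- Functions that are constant on the components of the new map are constant on those of the old one. -/
theorem invariant_of_new {q : X → V} (h1 : ∀ x, q (κ' x) = q x) (h2 : ∀ x, q (D x) = q x) (x : X) :
    q (κ x) = q x := by
  -- These two items lie at the same new vertex, and turning around it uses only `κ'` and `D`.
  have hturn : ∀ i < k, q (s (κ (e i))) = q (e i) := by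
    intro i hi
    conv_rhs => rw [← S.new_turn_hit hi]
    rw [pow_apply_invariant (f := κ' * D) (u := q) fun x => by rw [Perm.mul_apply, h1, h2]]
  have hstep : ∀ i < k, q (e (i + 1)) = q (e i) := by
    intro i hi
    rcases Nat.lt_or_ge (i + 1) k with hlt | hge
    · rw [← h1 (e i), S.new_path i hlt, hturn _ hlt]
    · have hk : i + 1 = k := by omega
      rw [← h1 (e i), S.new_last i hk, hk]
  have hshift : ∀ y, y ≠ e 0 → q (s y) = q y := by
    intro y hy
    by_cases hp : ∃ j < k, y = e (j + 1)
    · obtain ⟨j, hj, rfl⟩ := hp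
      rw [S.shift_path j hj, hstep j hj]
    · push Not at hp
      rw [S.shift_other]
      intro j hj
      cases j with
      | zero => exact hy
      | succ j => exact hp j hj
  by_cases hx : ∃ i < k, x = e i
  · obtain ⟨i, hi, rfl⟩ := hx
    rw [← hturn i hi, hshift]
    intro h0
    have h1 := S.level_next hi
    have h2 := S.level_path 0 (Nat.zero_le k)
    rw [h0] at h1
    omega
  · push Not at hx
    by_cases h0 : κ x = e 0
    · rw [h0, ← h1 x, S.new_first x hx h0, hturn 0 S.pos]
    · rw [← h1 x, S.new_other x hx h0, hshift _ h0]

/-- The reversed path in the new map takes the first possible edge at each step. -/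
theorem exists_reverse_turn {i : ℕ} (hi : i + 1 < k) :
    ∃ N, ((κ'⁻¹ * D⁻¹) ^ N) (κ'⁻¹ (e (i + 1))) = e i ∧ ∀ l < N,
      slid κ D k e n h (((κ'⁻¹ * D⁻¹) ^ l) (κ'⁻¹ (e (i + 1)))) + (i + 1) ≤ k := by
  classical
  -- Turning in the reverse orientation is the inverse of the new turn, conjugated by `κ'`.
  have hconj : ∀ l x, ((κ'⁻¹ * D⁻¹) ^ l) (κ'⁻¹ x) = κ'⁻¹ (((κ' * D) ^ l)⁻¹ x) := by
    intro l x
    have h1 : κ'⁻¹ * D⁻¹ = κ'⁻¹ * (κ' * D)⁻¹ * κ'⁻¹⁻¹ := by group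
    rw [h1, conj_pow, Perm.mul_apply, Perm.mul_apply, inv_pow]
    simp
  have hex : ∃ N, ((κ'⁻¹ * D⁻¹) ^ N) (κ'⁻¹ (e (i + 1))) = e i := by
    refine ⟨n (i + 1), ?_⟩
    rw [hconj, ← S.new_turn_hit hi, inv_apply_apply, ← S.new_path i hi, inv_apply_apply]
  -- The turn of `n (i + 1)` steps already reaches `e i`; the first arrival is taken instead, so
  -- that no intermediate item is `e i` itself.
  refine ⟨Nat.find hex, Nat.find_spec hex, fun l hl => ?_⟩
  have hne := Nat.find_min hex hl
  have hle : l < n (i + 1) := by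
    refine lt_of_lt_of_le hl (Nat.find_min' hex ?_)
    rw [hconj, ← S.new_turn_hit hi, inv_apply_apply, ← S.new_path i hi, inv_apply_apply]
  set y := ((κ'⁻¹ * D⁻¹) ^ l) (κ'⁻¹ (e (i + 1))) with hy
  have hκy : κ' y = s (((κ * D) ^ (n (i + 1) - l)) (κ (e (i + 1)))) := by
    rw [← S.new_turn_pow hi (Nat.sub_le _ _), hy, hconj, apply_inv_apply,
      Perm.inv_eq_iff_eq, ← Perm.mul_apply, ← pow_add, Nat.add_sub_cancel' hle.le,
      S.new_turn_hit hi]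
  have hl' : κ' y = e (i + 1) ∨ Left κ D e n (i + 1) (κ' y) := by
    rcases Nat.eq_zero_or_pos l with h0 | hpos
    · subst h0
      left
      rw [hκy, Nat.sub_zero, S.hit _ hi, S.shift_path _ hi]
    · right
      have hL : Left κ D e n (i + 1) (((κ * D) ^ (n (i + 1) - l)) (κ (e (i + 1)))) :=
        ⟨_, by omega, rfl⟩
      rwa [hκy, S.shift_left hi hL]
  have hH : slid κ D k e n h (κ' y) + (i + 1) = k := by
    rcases hl' with h1 | h1
    · rw [h1]; exact S.slid_level_path hi.le
    · exact S.slid_level_left hi h1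
  -- The item following `e j` in the new map has corrected level `k - (j + 1)`, so comparison with
  -- `hH` leaves only `j = i`, excluded by the first arrival.
  have hpath : ∀ j < k, y ≠ e j := by
    intro j hj hyj
    rcases Nat.lt_or_ge (j + 1) k with hlt | hge
    · have h1 := S.slid_shift_next h hlt
      rw [← S.new_path j hlt, ← hyj] at h1
      have h2 := S.level_path (j + 1) hlt.le
      have : j = i := by omega
      subst this
      exact hne hyj
    · have h1 := S.new_last j (by omega)
      have h2 := S.slid_level_path (le_refl k)
      rw [hyj, h1] at hH
      omega
  have h0 : κ y ≠ e 0 := by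
    intro h0
    have h1 := S.slid_shift_next h S.pos
    rw [← S.new_first y hpath h0] at h1
    have h2 := S.level_path 0 (Nat.zero_le k)
    omega
  have := S.slid_level_strict hpath h0 hi hl'
  omega

end SlitSlide

/-! ### Vertices, paths and distances in both orientations -/

theorem Orientation.reverse_reverse (O : Orientation) : O.reverse.reverse = O := by
  cases O <;> rfl

/-- An injective map of a finite set into itself is onto, so stability under `f` implies stability
under its inverse. -/
theorem apply_iff_of_forward {X : Type} [Finite X] {f : Perm X} {q : X → Prop}
    (h : ∀ x, q x → q (f x)) (x : X) : q (f x) ↔ q x := by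
  refine ⟨fun hx => ?_, h x⟩
  have h1 : Set.MapsTo f.symm {x | q x} {x | q x} :=
    Perm.perm_symm_mapsTo_of_mapsTo f fun x hx => h x hx
  simpa using h1 hx

theorem inv_invariant {X V : Type} {f : Perm X} {q : X → V} (h : ∀ x, q (f x) = q x) (x : X) :
    q (f⁻¹ x) = q x := by
  conv_rhs => rw [← apply_inv_apply f x, h]

theorem sameCycle_invariant {X V : Type} {f : Perm X} {q : X → V} (h : ∀ x, q (f x) = q x)
    {x y : X} (hxy : f.SameCycle x y) : q x = q y := by
  obtain ⟨n, rfl⟩ := hxy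
  cases n with
  | ofNat n => exact (pow_apply_invariant h n x).symm
  | negSucc n =>
    rw [zpow_negSucc]
    exact (inv_invariant (pow_apply_invariant h (n + 1)) x).symm

namespace MapData

variable {r : ℕ} (m : MapData r)

instance : Finite m.Edge := m.finite

instance : Finite m.Vertex := Quotient.finite _

/-- The vertex at the corner directly before an item, in the orientation `O`. -/
def vertexBefore (O : Orientation) (x : m.Item) : m.Vertex :=
  m.cornerVertex (m.cornerBefore O x)

theorem contourIn_reverse (O : Orientation) : m.contourIn O.reverse = (m.contourIn O)⁻¹ := by
  cases O
  · rfl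
  · exact (inv_inv _).symm

theorem darkIn_reverse (O : Orientation) : m.darkIn O.reverse = (m.darkIn O)⁻¹ := by
  cases O
  · rfl
  · exact (inv_inv _).symm

/-- The permutation that crosses the dark faces, from an outgoing edge to an incoming one. -/
def crossDark (O : Orientation) : Perm m.Item := Perm.sumCongr (m.darkIn O)⁻¹ 1

theorem turnIn_eq (O : Orientation) : m.turnIn O = m.contourIn O * m.crossDark O := rfl

theorem turnIn_reverse (O : Orientation) :
    m.turnIn O.reverse = (m.contourIn O)⁻¹ * (m.crossDark O)⁻¹ := by
  rw [crossDark, turnIn, contourIn_reverse, darkIn_reverse, Perm.sumCongr_inv, inv_one]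

/-- Reversing the orientation exchanges the items before and after a corner. This inverts the
rotation around vertices and conjugates it by the contour, so the vertices are the same. -/
theorem vertexBefore_eq_iff (O : Orientation) (x y : m.Item) :
    m.vertexBefore O x = m.vertexBefore O y ↔ (m.turnIn O).SameCycle x y := by
  cases O
  · exact Quotient.eq (r := Perm.SameCycle.setoid (m.turnIn .lightLeft))
  · refine (Quotient.eq (r := Perm.SameCycle.setoid (m.turnIn .lightLeft))).trans ?_
    change (m.turnIn .lightLeft).SameCycle (m.contour x) (m.contour y) ↔
      (m.turnIn (Orientation.reverse .lightLeft)).SameCycle x y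
    have h1 : m.turnIn (Orientation.reverse .lightLeft) =
        m.contour⁻¹ * (m.turnIn .lightLeft)⁻¹ * m.contour⁻¹⁻¹ := by
      rw [turnIn_reverse, turnIn_eq, contourIn]
      group
    rw [h1, Perm.sameCycle_conj, Perm.sameCycle_inv, inv_inv]

theorem vertexBefore_turnIn (O : Orientation) (x : m.Item) :
    m.vertexBefore O (m.turnIn O x) = m.vertexBefore O x := by
  rw [vertexBefore_eq_iff, Perm.sameCycle_apply_left]

theorem vertexBefore_itemAfter (O : Orientation) (c : m.Corner) :
    m.vertexBefore O (m.itemAfter O c) = m.cornerVertex c := by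
  cases O
  · rfl
  · exact congrArg m.cornerVertex (apply_inv_apply m.contour c)

theorem vertexBefore_reverse (O : Orientation) (x : m.Item) :
    m.vertexBefore O.reverse x = m.vertexBefore O (m.contourIn O x) := by
  cases O
  · rfl
  · exact congrArg m.cornerVertex (apply_inv_apply m.contour x).symm

theorem vertexBefore_surjective (O : Orientation) : Function.Surjective (m.vertexBefore O) := by
  intro v
  obtain ⟨c, rfl⟩ := Quotient.exists_rep v
  exact ⟨m.itemAfter O c, m.vertexBefore_itemAfter O c⟩

theorem origin_eq (O : Orientation) (e : m.Edge) :
    m.origin O e = m.vertexBefore O (Sum.inl e) := rfl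

theorem terminus_eq (O : Orientation) (e : m.Edge) :
    m.terminus O e = m.vertexBefore O (m.contourIn O (Sum.inl e)) := by
  cases O
  · rfl
  · exact congrArg m.cornerVertex (apply_inv_apply m.contour (Sum.inl e)).symm

theorem vertexBefore_contourIn_mark (O : Orientation) (i : Fin r) :
    m.vertexBefore O (m.contourIn O (Sum.inr i)) = m.vertexBefore O (Sum.inr i) :=
  m.vertexBefore_turnIn O (Sum.inr i)

theorem origin_reverse (O : Orientation) (e : m.Edge) : m.origin O.reverse e = m.terminus O e := by
  rw [origin_eq, terminus_eq, vertexBefore_reverse]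

theorem terminus_reverse (O : Orientation) (e : m.Edge) : m.terminus O.reverse e = m.origin O e := by
  rw [← origin_reverse, Orientation.reverse_reverse]

theorem cornerVertex_cornerAfter (O : Orientation) (x : m.Item) :
    m.cornerVertex (m.cornerAfter O x) = m.vertexBefore O (m.contourIn O x) := by
  cases O
  · rfl
  · exact congrArg m.cornerVertex (apply_inv_apply m.contour x).symm

theorem itemAfter_cornerAfter_reverse (O : Orientation) (x : m.Item) :
    m.itemAfter O.reverse (m.cornerAfter O x) = x := by
  cases O
  · exact inv_apply_apply m.contour x
  · rfl

theorem cornerAfter_reverse_itemAfter (O : Orientation) (c : m.Corner) :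
    m.cornerAfter O.reverse (m.itemAfter O c) = c := by
  cases O
  · rfl
  · exact apply_inv_apply m.contour c

/-- Orbits of `turnIn` are the fibres of `vertexBefore`; potentials can thus be built on items and
then used on vertices. -/
theorem exists_lift {V : Type} (O : Orientation) {q : m.Item → V}
    (hq : ∀ x, q (m.turnIn O x) = q x) :
    ∃ f : m.Vertex → V, ∀ x, f (m.vertexBefore O x) = q x := by
  refine ⟨fun v => q (Function.surjInv (m.vertexBefore_surjective O) v), fun x => ?_⟩
  refine sameCycle_invariant hq ((m.vertexBefore_eq_iff O _ _).1 ?_)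
  exact Function.surjInv_eq (m.vertexBefore_surjective O) _

theorem vertexBefore_darkIn (O : Orientation) (e : m.Edge) :
    m.vertexBefore O (Sum.inl (m.darkIn O e)) = m.terminus O e := by
  rw [terminus_eq, ← vertexBefore_turnIn, turnIn, Perm.mul_apply]
  congr 2
  exact congrArg Sum.inl (inv_apply_apply _ e)

variable {m} in
theorem IsPath.append {O : Orientation} {u v w : m.Vertex} {l l' : List m.Edge}
    (h : m.IsPath O u v l) (h' : m.IsPath O v w l') : m.IsPath O u w (l ++ l') := by
  induction l generalizing u with
  | nil => cases h; exact h'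
  | cons e l ih => exact ⟨h.1, ih h.2⟩

variable {m} in
theorem IsPath.reverse {O : Orientation} {u v : m.Vertex} {l : List m.Edge}
    (h : m.IsPath O u v l) : m.IsPath O.reverse v u l.reverse := by
  induction l generalizing u with
  | nil => exact h.symm
  | cons e l ih =>
    rw [List.reverse_cons]
    exact (ih h.2).append ⟨m.origin_reverse O e, (m.terminus_reverse O e).trans h.1⟩

theorem dist_reverse (O : Orientation) (u v : m.Vertex) :
    m.dist O.reverse u v = m.dist O v u := by
  unfold dist
  congr 1
  ext k
  constructor
  · rintro ⟨l, hl, rfl⟩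
    have h1 := hl.reverse
    rw [Orientation.reverse_reverse] at h1
    exact ⟨_, h1, List.length_reverse⟩
  · rintro ⟨l, hl, rfl⟩
    exact ⟨_, hl.reverse, List.length_reverse⟩

variable {m} in
theorem IsPath.dist_le {O : Orientation} {u v : m.Vertex} {l : List m.Edge}
    (h : m.IsPath O u v l) : m.dist O u v ≤ l.length := Nat.sInf_le ⟨l, h, rfl⟩

theorem dist_self (O : Orientation) (u : m.Vertex) : m.dist O u u = 0 :=
  Nat.le_zero.1 (IsPath.dist_le (l := []) (rfl : u = u))

/-- The map is connected: a property that is stable by moving around the faces holds for all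
items or for none. -/
def Transitive : Prop :=
  ∀ q : m.Item → Prop, (∀ x, q (m.contour x) = q x) →
    (∀ e, q (Sum.inl (m.dark e)) = q (Sum.inl e)) → ∀ x y, q x = q y

variable {m}

theorem Transitive.of_orientation (h : m.Transitive) (O : Orientation) {q : m.Item → Prop}
    (h1 : ∀ x, q (m.contourIn O x) = q x)
    (h2 : ∀ e, q (Sum.inl (m.darkIn O e)) = q (Sum.inl e)) (x y : m.Item) : q x = q y := by
  cases O
  · exact h q h1 h2 x y
  · refine h q (fun z => ?_) (fun e => ?_) x y
    · have := inv_invariant h1 z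
      rwa [contourIn, inv_inv] at this
    · have := inv_invariant (f := m.darkIn .lightRight) (q := fun e => q (Sum.inl e)) h2 e
      rwa [darkIn, inv_inv] at this

theorem transitive_of_orientation (O : Orientation)
    (h : ∀ q : m.Item → Prop, (∀ x, q (m.contourIn O x) = q x) →
      (∀ e, q (Sum.inl (m.darkIn O e)) = q (Sum.inl e)) → ∀ x y, q x = q y) : m.Transitive := by
  intro q h1 h2
  cases O
  · exact h q h1 h2
  · exact h q (inv_invariant h1) (inv_invariant (f := m.dark) (q := fun e => q (Sum.inl e)) h2)

/-- Strong connectivity: reachability from `x` is preserved by moving forward around light and dark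
faces, hence also backward by finiteness, and connectedness spreads it everywhere. -/
theorem Transitive.exists_isPath (h : m.Transitive) (O : Orientation) (u v : m.Vertex) :
    ∃ l, m.IsPath O u v l := by
  obtain ⟨x, rfl⟩ := m.vertexBefore_surjective O u
  obtain ⟨y, rfl⟩ := m.vertexBefore_surjective O v
  let q : m.Item → Prop := fun z => ∃ l, m.IsPath O (m.vertexBefore O x) (m.vertexBefore O z) l
  have hstep : ∀ e, q (Sum.inl e) → ∃ l, m.IsPath O (m.vertexBefore O x) (m.terminus O e) l := by
    rintro e ⟨l, hl⟩
    exact ⟨l ++ [e], hl.append ⟨rfl, rfl⟩⟩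
  have hq : q x = q y := by
    refine h.of_orientation O (q := q) (fun z => ?_) (fun e => ?_) x y
    · refine propext (apply_iff_of_forward (q := q) (fun z hz => ?_) z)
      cases z with
      | inl e =>
        obtain ⟨l, hl⟩ := hstep e hz
        rw [terminus_eq] at hl
        exact ⟨l, hl⟩
      | inr i =>
        obtain ⟨l, hl⟩ := hz
        refine ⟨l, ?_⟩
        rwa [vertexBefore_contourIn_mark]
    · refine propext (apply_iff_of_forward (q := fun e => q (Sum.inl e)) (fun e he => ?_) e)
      obtain ⟨l, hl⟩ := hstep e he
      rw [← vertexBefore_darkIn] at hl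
      exact ⟨l, hl⟩
  exact hq.mp ⟨[], rfl⟩

theorem Transitive.exists_shortest (h : m.Transitive) (O : Orientation) (u v : m.Vertex) :
    ∃ l, m.IsPath O u v l ∧ l.length = m.dist O u v :=
  Nat.sInf_mem (s := {k | ∃ l, m.IsPath O u v l ∧ l.length = k})
    ((h.exists_isPath O u v).imp' List.length fun l hl => ⟨l, hl, rfl⟩)

theorem Transitive.eq_of_dist (h : m.Transitive) {O : Orientation} {u v : m.Vertex}
    (h0 : m.dist O u v = 0) : u = v := by
  obtain ⟨l, hl, hlen⟩ := h.exists_shortest O u v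
  rw [h0, List.length_eq_zero_iff] at hlen
  subst hlen
  exact hl

theorem Transitive.dist_contourIn (h : m.Transitive) (O : Orientation) (v : m.Vertex) (x : m.Item) :
    m.dist O (m.vertexBefore O x) v ≤ m.dist O (m.vertexBefore O (m.contourIn O x)) v + 1 := by
  cases x with
  | inl e =>
    obtain ⟨l, hl, hlen⟩ := h.exists_shortest O (m.vertexBefore O (m.contourIn O (Sum.inl e))) v
    rw [← terminus_eq] at hl
    have h1 : m.IsPath O (m.vertexBefore O (Sum.inl e)) v (e :: l) := ⟨rfl, hl⟩
    rw [← hlen]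
    exact h1.dist_le
  | inr i =>
    rw [vertexBefore_contourIn_mark]
    exact Nat.le_succ _

/-- A potential that decreases at most by one along edges bounds the distance from below. -/
theorem Transitive.le_dist (h : m.Transitive) {O : Orientation} {f : m.Vertex → ℕ}
    (hf : ∀ e, f (m.origin O e) ≤ f (m.terminus O e) + 1) (u v : m.Vertex) :
    f u ≤ f v + m.dist O u v := by
  obtain ⟨l, hl, hlen⟩ := h.exists_shortest O u v
  rw [← hlen]
  clear hlen
  induction l generalizing u with
  | nil => cases hl; simp
  | cons e l ih =>
    have h1 := ih _ hl.2
    have h2 := hf e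
    rw [hl.1] at h2
    rw [List.length_cons]
    omega

/-! ### Lightest geodesics as sequences of first closer edges -/

theorem isCloser_inl {O : Orientation} {v : m.Vertex} {e : m.Edge} :
    m.IsCloser O v (Sum.inl e) ↔ m.dist O (m.terminus O e) v + 1 = m.dist O (m.origin O e) v := by
  constructor
  · rintro ⟨e', he, h⟩
    cases he
    exact h
  · exact fun h => ⟨e, rfl, h⟩

theorem Transitive.exists_closer (h : m.Transitive) {O : Orientation} {v : m.Vertex} {x : m.Item}
    (hx : 0 < m.dist O (m.vertexBefore O x) v) : ∃ n : ℕ, m.IsCloser O v ((m.turnIn O ^ n) x) := by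
  obtain ⟨l, hl, hlen⟩ := h.exists_shortest O (m.vertexBefore O x) v
  cases l with
  | nil => rw [← hlen] at hx; exact absurd hx (lt_irrefl 0)
  | cons e l =>
    have h1 : m.vertexBefore O x = m.vertexBefore O (Sum.inl e) := hl.1.symm
    obtain ⟨n, hn⟩ := ((m.vertexBefore_eq_iff O _ _).1 h1).exists_nat_pow_eq
    refine ⟨n, ?_⟩
    rw [hn, isCloser_inl]
    have h2 := hl.2.dist_le
    have h3 := h.dist_contourIn O v (Sum.inl e)
    rw [← terminus_eq, ← origin_eq] at h3
    rw [← hl.1, List.length_cons] at hlen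
    omega

variable (m) in
/-- The edge `e` is the first one going closer to `v` that is met when turning from the item `x`. -/
def IsFirst (O : Orientation) (v : m.Vertex) (x : m.Item) (e : m.Edge) : Prop :=
  ∃ n : ℕ, (m.turnIn O ^ n) x = Sum.inl e ∧ m.IsCloser O v (Sum.inl e) ∧
    ∀ l < n, ¬ m.IsCloser O v ((m.turnIn O ^ l) x)

theorem IsFirst.firstCloser_eq {O : Orientation} {v : m.Vertex} {x : m.Item} {e : m.Edge}
    (h : m.IsFirst O v x e) : m.firstCloser O v x = some e := by
  obtain ⟨n, h1, h2, h3⟩ := h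
  have hn : sInf {n : ℕ | m.IsCloser O v ((m.turnIn O ^ n) x)} = n := by
    have hmem : n ∈ {n : ℕ | m.IsCloser O v ((m.turnIn O ^ n) x)} := by
      rw [Set.mem_ofPred_eq, h1]
      exact h2
    refine le_antisymm (Nat.sInf_le hmem) ?_
    by_contra hlt
    exact h3 _ (not_le.1 hlt) (Nat.sInf_mem ⟨n, hmem⟩)
  rw [firstCloser, hn, h1]
  rfl

theorem IsFirst.vertexBefore_eq {O : Orientation} {v : m.Vertex} {x : m.Item} {e : m.Edge}
    (h : m.IsFirst O v x e) : m.vertexBefore O (Sum.inl e) = m.vertexBefore O x := by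
  obtain ⟨n, h1, -, -⟩ := h
  rw [← h1, pow_apply_invariant (m.vertexBefore_turnIn O)]

theorem IsFirst.dist_eq {O : Orientation} {v : m.Vertex} {x : m.Item} {e : m.Edge}
    (h : m.IsFirst O v x e) : m.dist O (m.vertexBefore O (m.contourIn O (Sum.inl e))) v + 1 =
      m.dist O (m.vertexBefore O x) v := by
  rw [← h.vertexBefore_eq, ← terminus_eq, ← origin_eq]
  exact isCloser_inl.1 h.choose_spec.2.1

theorem Transitive.exists_isFirst (h : m.Transitive) {O : Orientation} {v : m.Vertex} {x : m.Item}
    (hx : 0 < m.dist O (m.vertexBefore O x) v) : ∃ e, m.IsFirst O v x e := by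
  classical
  have hex := h.exists_closer hx
  obtain ⟨e, he, h1⟩ := Nat.find_spec hex
  exact ⟨e, Nat.find hex, he, isCloser_inl.2 h1, fun l hl => Nat.find_min hex hl⟩

theorem geodesicSteps_eq {O : Orientation} {v : m.Vertex} {k : ℕ} {x : m.Item} {g : ℕ → m.Edge}
    (h0 : 0 < k → m.IsFirst O v x (g 0))
    (hs : ∀ i, i + 1 < k → m.IsFirst O v (m.contourIn O (Sum.inl (g i))) (g (i + 1))) :
    m.geodesicSteps O v k x = (List.range k).map g := by
  induction k generalizing x g with
  | zero => rfl
  | succ k ih =>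
    rw [geodesicSteps, (h0 k.succ_pos).firstCloser_eq, List.range_succ_eq_map, List.map_cons,
      List.map_map]
    simp only
    rw [ih (g := g ∘ Nat.succ)]
    · exact fun hk => hs 0 (by omega)
    · exact fun i hi => hs (i + 1) (by omega)

/-- The edge `e` serves only as a default value of `g` when the distance is zero. -/
theorem Transitive.exists_geodesic (h : m.Transitive) {O : Orientation} {v : m.Vertex} {k : ℕ}
    {x : m.Item} (e : m.Edge) (hk : m.dist O (m.vertexBefore O x) v = k) :
    ∃ g : ℕ → m.Edge, (0 < k → m.IsFirst O v x (g 0)) ∧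
      ∀ i, i + 1 < k → m.IsFirst O v (m.contourIn O (Sum.inl (g i))) (g (i + 1)) := by
  induction k generalizing x with
  | zero => exact ⟨fun _ => e, fun h => absurd h (lt_irrefl 0), fun i hi => absurd hi (by omega)⟩
  | succ k ih =>
    obtain ⟨f, hf⟩ := h.exists_isFirst (x := x) (v := v) (O := O) (by omega)
    have hd := hf.dist_eq
    obtain ⟨g, hg0, hg⟩ := ih (x := m.contourIn O (Sum.inl f)) (by omega)
    refine ⟨fun i => Nat.casesOn i f g, fun _ => hf, fun i hi => ?_⟩
    cases i with
    | zero => exact hg0 (by omega)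
    | succ i => exact hg i (by omega)

end MapData

/-! ### Moving one element of a permutation to another place -/

open Classical in
/-- The contours after `a` has been removed and inserted again directly before `c`. -/
noncomputable def reinsert {X : Type} (κ : Perm X) (a c : X) : Perm X :=
  swap a (κ a) * κ * swap ((swap a (κ a) * κ)⁻¹ c) a

section Reinsert

variable {X V : Type} {κ : Perm X} {a c : X}

open Classical in
theorem reinsert_eq (κ : Perm X) (a c : X) :
    reinsert κ a c = swap c a * (swap a (κ a) * κ) := by
  rw [reinsert, mul_swap_eq_swap_mul, apply_inv_apply, Perm.mul_apply, swap_apply_right]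

open Classical in
theorem reinsert_self (κ : Perm X) (a c : X) : reinsert κ a c a = c := by
  simp [reinsert_eq]

open Classical in
theorem reinsert_before (ha : κ a ≠ a) (hc : κ a ≠ c) {x : X} (hx : κ x = a) :
    reinsert κ a c x = κ a := by
  simp [reinsert_eq, hx, swap_apply_of_ne_of_ne hc ha]

open Classical in
theorem reinsert_corner (hca : c ≠ a) (hc : κ a ≠ c) {x : X} (hx : κ x = c) :
    reinsert κ a c x = a := by
  simp [reinsert_eq, hx, swap_apply_of_ne_of_ne hca hc.symm]

open Classical in
theorem reinsert_other {x : X} (hxa : x ≠ a) (ha : κ x ≠ a) (hc : κ x ≠ c) :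
    reinsert κ a c x = κ x := by
  have h1 : κ x ≠ κ a := fun h => hxa (κ.injective h)
  simp [reinsert_eq, swap_apply_of_ne_of_ne ha h1, swap_apply_of_ne_of_ne hc ha]

/-- In the inverse permutation the old predecessor of `a` becomes its successor, so reinserting `a`
before `κ⁻¹ a` restores its place. -/
theorem reinsert_reinsert (hca : c ≠ a) (hc : κ a ≠ c) :
    reinsert (reinsert κ a c)⁻¹ a (κ⁻¹ a) = κ⁻¹ := by
  classical
  have h1 : (reinsert κ a c)⁻¹ a = κ⁻¹ c := by
    rw [Perm.inv_eq_iff_eq, reinsert_corner hca hc (apply_inv_apply κ c)]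
  have h2 : κ⁻¹ c ≠ a := fun h => hc (by rw [← h, apply_inv_apply])
  have h3 : κ⁻¹ c ≠ κ⁻¹ a := fun h => hca (κ⁻¹.injective h)
  rw [reinsert_eq, h1, ← mul_assoc, mul_inv_eq_iff_eq_mul, reinsert_eq, ← mul_assoc, ← mul_assoc,
    mul_swap_eq_swap_mul κ⁻¹, mul_assoc, mul_assoc, ← mul_assoc κ⁻¹, mul_swap_eq_swap_mul κ⁻¹,
    inv_apply_apply, mul_assoc (swap _ _) κ⁻¹ κ, inv_mul_cancel, mul_one,
    mul_swap_eq_swap_mul, swap_apply_right, swap_apply_of_ne_of_ne h3 h2, swap_comm (κ⁻¹ a) (κ⁻¹ c)]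

/-- The functions of the faces after the move induced by functions of the faces before it. -/
theorem update_reinsert [DecidableEq X] (ha : κ a ≠ a) (hca : c ≠ a) (hc : κ a ≠ c) {u : X → V}
    (hu : ∀ x, u (κ x) = u x) (x : X) :
    Function.update u a (u c) (reinsert κ a c x) = Function.update u a (u c) x := by
  by_cases hx : x = a
  · rw [hx, reinsert_self, Function.update_self, Function.update_of_ne hca]
  · rw [Function.update_of_ne hx]
    by_cases h1 : κ x = a
    · rw [reinsert_before ha hc h1, Function.update_of_ne ha, hu, ← h1, hu]
    · by_cases h2 : κ x = c
      · rw [reinsert_corner hca hc h2, Function.update_self, ← h2, hu]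
      · rw [reinsert_other hx h1 h2, Function.update_of_ne h1, hu]

theorem update_of_reinsert [DecidableEq X] (ha : κ a ≠ a) (hca : c ≠ a) (hc : κ a ≠ c) {q : X → V}
    (hq : ∀ x, q (reinsert κ a c x) = q x) (x : X) :
    Function.update q a (q (κ a)) (κ x) = Function.update q a (q (κ a)) x := by
  by_cases hx : x = a
  · rw [hx, Function.update_self, Function.update_of_ne ha]
  · rw [Function.update_of_ne hx]
    by_cases h1 : κ x = a
    · rw [h1, Function.update_self, ← hq x, reinsert_before ha hc h1]
    · rw [Function.update_of_ne h1]
      by_cases h2 : κ x = c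
      · rw [h2, ← hq x, reinsert_corner hca hc h2, ← hq a, reinsert_self]
      · rw [← hq x, reinsert_other hx h1 h2]

/-- Each implication transports the invariant "being in the cycle of `x`" from one permutation to
the other; only its value at `a` has to be redefined. -/
theorem sameCycle_reinsert [DecidableEq X] (ha : κ a ≠ a) (hca : c ≠ a) (hc : κ a ≠ c) {x : X}
    (hx : x ≠ a) (y : X) :
    (reinsert κ a c).SameCycle x y ↔ κ.SameCycle x (if y = a then c else y) := by
  constructor
  · intro h
    have h1 := sameCycle_invariant (update_reinsert ha hca hc (u := κ.SameCycle x)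
      fun z => propext Perm.sameCycle_apply_right) h
    rw [Function.update_of_ne hx, Function.update_apply] at h1
    split_ifs at h1 ⊢ with h2
    · exact h1.mp (Perm.SameCycle.refl _ _)
    · exact h1.mp (Perm.SameCycle.refl _ _)
  · intro h
    have h1 := sameCycle_invariant (update_of_reinsert ha hca hc
      (q := (reinsert κ a c).SameCycle x) fun z => propext Perm.sameCycle_apply_right) h
    rw [Function.update_of_ne hx] at h1
    split_ifs at h1 with h2
    · rw [Function.update_of_ne hca] at h1
      rw [h2, ← Perm.sameCycle_apply_right, reinsert_self]
      exact h1.mp (Perm.SameCycle.refl _ _)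
    · rw [Function.update_of_ne h2] at h1
      exact h1.mp (Perm.SameCycle.refl _ _)

end Reinsert

/-! ### The operation on maps obeys the local rules -/

namespace Pointed

variable {r : ℕ}

/-- The hypotheses under which the slit-slide-sew operation in the orientation `O` can be reverted: the map
is connected, the distinguished corner and edge are in different faces, and the edge goes closer to
the vertex at the corner. -/
structure Slidable (O : Orientation) (t : Pointed r) : Prop where
  transitive : t.map.Transitive
  separated : ¬ (t.map.contourIn O).SameCycle (Sum.inl t.edge) (t.map.itemAfter O t.corner)
  closer : t.map.IsCloser O (t.map.cornerVertex t.corner) (Sum.inl t.edge)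

variable (O : Orientation) (t : Pointed r)

/-- The distance from the corner before an item to the distinguished corner. -/
noncomputable def level (x : t.map.Item) : ℕ :=
  t.map.dist O (t.map.vertexBefore O x) (t.map.cornerVertex t.corner)

/-- The sequence made of the first `k` values of `g` and then the item following the distinguished corner. -/
def pathItem (k : ℕ) (g : ℕ → t.map.Edge) (i : ℕ) : t.map.Item :=
  if i < k then Sum.inl (g i) else t.map.itemAfter O t.corner

open Classical in
/-- The new item that precedes the new position of a corner, named after the item following the corner. -/
noncomputable def shiftItem (y : t.map.Item) : t.map.Item :=
  t.rename O (if y = t.map.itemAfter O t.corner then Sum.inl t.edge else y)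

theorem inserted_eq :
    t.inserted O = reinsert (t.map.contourIn O) (Sum.inl t.edge) (t.map.itemAfter O t.corner) := by
  simp only [inserted, removed, reinsert]
  congr!

theorem slidContour_rename (x : t.map.Item) :
    t.slidContour O (t.rename O x) = t.rename O (t.inserted O x) := by
  rw [slidContour, Perm.mul_apply, Perm.mul_apply, inv_apply_apply]

theorem contourIn_slidMap : (t.slidMap O).contourIn O = t.slidContour O := by
  cases O
  · rfl
  · exact inv_inv _

variable {O t} {k : ℕ} {g : ℕ → t.map.Edge}

theorem pathItem_of_lt {i : ℕ} (hi : i < k) : t.pathItem O k g i = Sum.inl (g i) := if_pos hi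

theorem pathItem_last : t.pathItem O k g k = t.map.itemAfter O t.corner := if_neg (lt_irrefl k)

theorem rename_of_notMem (hl : t.slidingPath O = (List.range k).map g) {x : t.map.Item}
    (hx : ∀ i < k, x ≠ Sum.inl (g i)) : t.rename O x = x := by
  classical
  cases x with
  | inl e =>
    refine congrArg Sum.inl ?_
    rw [Perm.inv_eq_iff_eq]
    refine (List.formPerm_apply_of_notMem ?_).symm
    rw [hl, List.mem_map]
    rintro ⟨i, hi, rfl⟩
    exact hx i (List.mem_range.1 hi) rfl
  | inr i => rfl

/-- The reduction modulo `k` covers the wrap-around: the name of the first edge, borne by the new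
light side, becomes that of the last. -/
theorem rename_path (hl : t.slidingPath O = (List.range k).map g)
    (hg : ∀ i < k, ∀ j < k, g i = g j → i = j) {i : ℕ} (hi : i < k) :
    t.rename O (Sum.inl (g ((i + 1) % k))) = Sum.inl (g i) := by
  classical
  refine congrArg Sum.inl ?_
  rw [Perm.inv_eq_iff_eq, hl]
  have hnd : ((List.range k).map g).Nodup := by
    refine List.Nodup.map_on ?_ List.nodup_range
    intro x hx y hy
    exact hg x (List.mem_range.1 hx) y (List.mem_range.1 hy)
  have h1 := List.formPerm_apply_getElem _ hnd i (by simpa using hi)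
  simp only [List.getElem_map, List.getElem_range, List.length_map, List.length_range] at h1
  convert h1.symm

theorem Slidable.corner_ne (h : t.Slidable O) : t.map.itemAfter O t.corner ≠ Sum.inl t.edge :=
  fun h1 => h.separated (h1 ▸ Perm.SameCycle.refl _ _)

theorem Slidable.contour_ne_corner (h : t.Slidable O) :
    t.map.contourIn O (Sum.inl t.edge) ≠ t.map.itemAfter O t.corner := by
  intro h1
  refine h.separated ?_
  rw [← h1]
  exact (Perm.SameCycle.refl _ _).apply_right

theorem Slidable.contour_ne_edge (h : t.Slidable O) :
    t.map.contourIn O (Sum.inl t.edge) ≠ Sum.inl t.edge := by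
  intro h1
  have h2 := MapData.isCloser_inl.1 h.closer
  rw [MapData.terminus_eq, h1, MapData.origin_eq] at h2
  omega

/-- The slit-slide-sew operation follows the local rules. -/
theorem Slidable.exists_slitSlide (h : t.Slidable O) : ∃ (k : ℕ) (g : ℕ → t.map.Edge) (n : ℕ → ℕ),
    t.slidingPath O = (List.range k).map g ∧ g 0 = t.edge ∧
    (∀ i < k, ∀ j < k, g i = g j → i = j) ∧
    SlitSlide (t.map.contourIn O) (t.map.crossDark O) (t.slidContour O) (t.shiftItem O) k
      (t.pathItem O k g) n (t.level O) := by
  classical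
  set v := t.map.cornerVertex t.corner with hv
  have htr := h.transitive
  obtain ⟨k, hk⟩ : ∃ k, t.map.dist O (t.map.vertexBefore O (Sum.inl t.edge)) v = k := ⟨_, rfl⟩
  have hpos : 0 < k := by
    have : t.map.dist O (t.map.terminus O t.edge) v + 1 =
        t.map.dist O (t.map.vertexBefore O (Sum.inl t.edge)) v := MapData.isCloser_inl.1 h.closer
    omega
  obtain ⟨g, hg0, hgs⟩ := htr.exists_geodesic t.edge hk
  have hl : t.slidingPath O = (List.range k).map g := by
    rw [← MapData.geodesicSteps_eq hg0 hgs, ← hk]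
    rfl
  have hedge : g 0 = t.edge := by
    have h1 : t.map.IsFirst O v (Sum.inl t.edge) t.edge :=
      ⟨0, rfl, h.closer, fun l hl => absurd hl (Nat.not_lt_zero l)⟩
    have h2 := (hg0 hpos).firstCloser_eq
    rw [h1.firstCloser_eq] at h2
    exact (Option.some.inj h2).symm
  have hclose : ∀ i < k, t.map.IsCloser O v (Sum.inl (g i)) := by
    intro i hi
    cases i with
    | zero => rw [hedge]; exact h.closer
    | succ i => exact (hgs i hi).choose_spec.2.1
  have hnext : ∀ i < k, t.level O (t.map.contourIn O (Sum.inl (g i))) + 1 = t.level O (Sum.inl (g i)) := by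
    intro i hi
    have := MapData.isCloser_inl.1 (hclose i hi)
    rwa [MapData.terminus_eq] at this
  have hlev : ∀ i < k, t.level O (Sum.inl (g i)) + i = k := by
    intro i hi
    induction i with
    | zero => rw [hedge]; exact hk
    | succ i ih =>
      have h1 := ih (by omega)
      have h2 := hnext i (by omega)
      have h3 : t.level O (Sum.inl (g (i + 1))) = t.level O (t.map.contourIn O (Sum.inl (g i))) := by
        rw [level, (hgs i hi).vertexBefore_eq]; rfl
      omega
  -- Levels strictly decrease along the path, so it repeats no edge and `formPerm` acts on it as a
  -- genuine cycle.
  have hinj : ∀ i < k, ∀ j < k, g i = g j → i = j := by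
    intro i hi j hj hij
    have h1 := hlev i hi
    have h2 := hlev j hj
    rw [hij] at h1
    omega
  set c := t.map.itemAfter O t.corner with hc
  have hlevc : t.level O c = 0 := by
    rw [level, hc, MapData.vertexBefore_itemAfter, MapData.dist_self]
  have hcp : ∀ i < k, Sum.inl (g i) ≠ c := by
    intro i hi hic
    have h1 := hlev i hi
    rw [hic, hlevc] at h1
    omega
  set e := t.pathItem O k g with he
  have he1 : ∀ i < k, e i = Sum.inl (g i) := fun i hi => pathItem_of_lt hi
  have hek : e k = c := pathItem_last
  have hlight : ∀ x : t.map.Item, ¬ t.map.IsCloser O v x → t.level O x ≤ t.level O (t.map.contourIn O x) := by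
    intro x hx
    have h1 : t.level O x ≤ t.level O (t.map.contourIn O x) + 1 := htr.dist_contourIn O v x
    cases x with
    | inl f =>
      have h2 : ¬ (t.level O (t.map.contourIn O (Sum.inl f)) + 1 = t.level O (Sum.inl f)) := by
        rw [MapData.isCloser_inl, MapData.terminus_eq] at hx
        exact hx
      omega
    | inr i => rw [level, level, MapData.vertexBefore_contourIn_mark]
  have hn : ∀ i < k, ∃ n : ℕ, ((t.map.turnIn O) ^ n) (t.map.contourIn O (e i)) = e (i + 1) ∧
      (∀ l < n, ((t.map.turnIn O) ^ l) (t.map.contourIn O (e i)) ≠ e (i + 1)) ∧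
      ∀ l < n, t.level O (((t.map.turnIn O) ^ l) (t.map.contourIn O (e i))) ≤
        t.level O (t.map.contourIn O (((t.map.turnIn O) ^ l) (t.map.contourIn O (e i)))) := by
    intro i hi
    rcases Nat.lt_or_ge (i + 1) k with hlt | hge
    · obtain ⟨n, h1, h2, h3⟩ := hgs i hlt
      rw [he1 i hi, he1 _ hlt]
      refine ⟨n, h1, fun l hl hle => h3 l hl ?_, fun l hl => hlight _ (h3 l hl)⟩
      rw [hle]
      exact h2
    -- After the last edge the turn ends at the distinguished corner, which lies at the same vertex.
    -- The condition `light` is trivial there because the level is zero.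
    · have hik : i + 1 = k := by omega
      have h1 : t.level O (t.map.contourIn O (e i)) = 0 := by
        have h2 := hnext i hi
        have h3 := hlev i hi
        rw [he1 i hi]
        omega
      have h2 : t.map.vertexBefore O (t.map.contourIn O (e i)) = t.map.vertexBefore O c := by
        rw [htr.eq_of_dist h1, hc, MapData.vertexBefore_itemAfter]
      have hex : ∃ n : ℕ, ((t.map.turnIn O) ^ n) (t.map.contourIn O (e i)) = e (i + 1) := by
        rw [hik, hek]
        exact ((t.map.vertexBefore_eq_iff O _ _).1 h2).exists_nat_pow_eq
      refine ⟨Nat.find hex, Nat.find_spec hex, fun l hl => Nat.find_min hex hl, fun l _ => ?_⟩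
      rw [level, pow_apply_invariant (t.map.vertexBefore_turnIn O)]
      exact (Nat.le_zero.2 h1).trans (Nat.zero_le _)
  choose! n hn1 hn2 hn3 using hn
  set a : t.map.Item := Sum.inl t.edge with ha
  have he0 : e 0 = a := by rw [he1 0 hpos, hedge]
  have hca : c ≠ a := h.corner_ne
  have hac : t.map.contourIn O a ≠ c := h.contour_ne_corner
  have haa : t.map.contourIn O a ≠ a := h.contour_ne_edge
  have hlea : t.level O a = k := hk
  have hren : ∀ i, i + 1 < k → t.rename O (e (i + 1)) = e i := by
    intro i hi
    rw [he1 _ hi, he1 i (by omega), ← rename_path hl hinj (show i < k by omega), Nat.mod_eq_of_lt hi]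
  have hrenlast : ∀ i, i + 1 = k → t.rename O a = e i := by
    intro i hi
    rw [he1 i (by omega), ← rename_path hl hinj (show i < k by omega), hi, Nat.mod_self, hedge]
  have hrene : ∀ x, (∀ i < k, x ≠ e i) → t.rename O x = x := by
    intro x hx
    refine rename_of_notMem hl fun i hi => ?_
    rw [← he1 i hi]
    exact hx i hi
  have hins : ∀ x, x ≠ a → t.map.contourIn O x ≠ a →
      t.rename O (t.inserted O x) = t.shiftItem O (t.map.contourIn O x) := by
    intro x hxa hκ
    rw [shiftItem]
    by_cases h1 : t.map.contourIn O x = c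
    · rw [if_pos h1, inserted_eq, reinsert_corner hca hac h1]
    · rw [if_neg h1, inserted_eq, reinsert_other hxa hκ h1]
  have hlevel_ne : ∀ i < k, t.map.contourIn O (e i) ≠ a := by
    intro i hi h1
    have h2 := hnext i hi
    have h3 := hlev i hi
    rw [he1 i hi] at h1
    rw [h1] at h2
    omega
  refine ⟨k, g, n, hl, hedge, hinj, ?_⟩
  exact
    { pos := hpos
      level_turn := fun x => congrArg (fun w => t.map.dist O w v) (t.map.vertexBefore_turnIn O x)
      level_le := fun x => htr.dist_contourIn O v x
      level_path := by
        intro i hi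
        rcases Nat.lt_or_ge i k with hlt | hge
        · rw [← he, he1 i hlt]; exact hlev i hlt
        · have : i = k := by omega
          subst this
          rw [← he, hek, hlevc, zero_add]
      hit := hn1
      hit_min := hn2
      light := hn3
      shift_path := by
        intro j hj
        rcases Nat.lt_or_ge (j + 1) k with hlt | hge
        · rw [← he, shiftItem, if_neg, hren j hlt]
          rw [he1 _ hlt]
          exact hcp _ hlt
        · have hjk : j + 1 = k := by omega
          rw [← he, hjk, hek, shiftItem, if_pos rfl, hrenlast j hjk]
      shift_other := by
        intro y hy
        rw [shiftItem, if_neg, hrene y fun i hi => hy i hi.le]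
        rw [← hc, ← hek]
        exact hy k le_rfl
      new_path := by
        intro i hi
        rw [← he, ← hren i hi, slidContour_rename, hins _ _ (hlevel_ne _ hi)]
        intro h1
        rw [he1 _ hi] at h1
        have h2 := hlev _ hi
        rw [h1, hlea] at h2
        omega
      new_last := by
        intro i hi
        rw [← he, ← hrenlast i hi, slidContour_rename, inserted_eq, reinsert_self, hrene, hek]
        intro j hj
        rw [he1 j hj]
        exact (hcp j hj).symm
      new_first := by
        intro y hy hκ
        rw [← he, he0] at hκ ⊢
        rw [← hrene y hy, slidContour_rename, inserted_eq, reinsert_before haa hac hκ, shiftItem,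
          if_neg hac]
      new_other := by
        intro y hy hκ
        rw [← he, he0] at hκ
        have hya : y ≠ a := by rw [← he0]; exact hy 0 hpos
        conv_lhs => rw [← hrene y hy, slidContour_rename, hins y hya hκ] }

end Pointed

/-! ### Distances and the reversed geodesic in the new map -/

open Classical in
theorem reinsert_conj {X : Type} (ρ κ : Perm X) (a c : X) :
    reinsert (ρ * κ * ρ⁻¹) (ρ a) (ρ c) = ρ * reinsert κ a c * ρ⁻¹ := by
  have h1 : (ρ * κ * ρ⁻¹) (ρ a) = ρ (κ a) := by
    rw [Perm.mul_apply, Perm.mul_apply, inv_apply_apply]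
  rw [reinsert_eq, reinsert_eq, h1, swap_apply_apply, swap_apply_apply]
  group

theorem inv_conj_conj {G : Type} [Group G] (a b : G) : a⁻¹ * (a * b * a⁻¹) * a⁻¹⁻¹ = b := by
  group

theorem getLast_map_range {α : Type} {k : ℕ} (hk : 0 < k) (g : ℕ → α) (d : α) :
    ((List.range k).map g).getLast?.getD d = g (k - 1) := by
  obtain ⟨k, rfl⟩ := Nat.exists_eq_succ_of_ne_zero hk.ne'
  simp [List.range_succ]

theorem map_range_reverse {α : Type} (k : ℕ) (g : ℕ → α) :
    (List.range k).map (fun i => g (k - 1 - i)) = ((List.range k).map g).reverse := by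
  refine List.ext_getElem (by simp) fun i h1 h2 => ?_
  simp

namespace MapData

variable {r : ℕ} {M : MapData r} {O : Orientation} {κ : Perm M.Item} {s : M.Item → M.Item} {k : ℕ}
  {e : ℕ → M.Item} {n : ℕ → ℕ} {h : M.Item → ℕ}

/-- The new map is connected if the old one is. -/
theorem transitive_of_slitSlide (S : SlitSlide κ (M.crossDark O) (M.contourIn O) s k e n h)
    (hold : ∀ q : M.Item → Prop, (∀ x, q (κ x) = q x) →
      (∀ f, q (Sum.inl (M.darkIn O f)) = q (Sum.inl f)) → ∀ x y, q x = q y) : M.Transitive := by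
  refine transitive_of_orientation O fun q h1 h2 => ?_
  refine hold q (S.invariant_of_new h1 fun x => ?_) h2
  cases x with
  | inl f => exact inv_invariant (f := M.darkIn O) (q := fun f => q (Sum.inl f)) h2 f
  | inr i => rfl

/-- The new map has at least as many vertices as the old one. -/
theorem card_le_of_slitSlide (S : SlitSlide κ (M.crossDark O) (M.contourIn O) s k e n h) {V : Type}
    {u : M.Item → V} (hu : ∀ x, u (κ (M.crossDark O x)) = u x) (hsurj : Function.Surjective u) :
    Nat.card V ≤ Nat.card M.Vertex := by
  obtain ⟨f, hf⟩ := M.exists_lift O (S.slid_turn hu)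
  refine Nat.card_le_card_of_surjective f fun v => ?_
  obtain ⟨x, rfl⟩ := hsurj v
  obtain ⟨y, hy⟩ := S.slid_surjective hu x
  exact ⟨M.vertexBefore O y, by rw [hf, hy]⟩

variable (S : SlitSlide κ (M.crossDark O) (M.contourIn O) s k e n h)

include S

theorem vertexBefore_shift {i : ℕ} (hi : i < k) :
    M.vertexBefore O (s (κ (e i))) = M.vertexBefore O (e i) := by
  conv_rhs => rw [← S.new_turn_hit hi]
  rw [← turnIn_eq, pow_apply_invariant (M.vertexBefore_turnIn O)]

/-- The path, with its new names, is still a directed path of the new map in the orientation `O`. -/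
theorem vertexBefore_next {i : ℕ} (hi : i < k) :
    M.vertexBefore O (M.contourIn O (e i)) = M.vertexBefore O (e (i + 1)) := by
  rcases Nat.lt_or_ge (i + 1) k with hlt | hge
  · rw [S.new_path i hlt, vertexBefore_shift S hlt]
  · have hk : i + 1 = k := by omega
    rw [S.new_last i hk, hk]

/-- The corrected level is `k` at `e 0` and drops by at most one per edge, whence the lower bound on
distances. -/
theorem le_slid_add_dist (htr : M.Transitive) (x : M.Item) :
    k ≤ SlitSlide.slid κ (M.crossDark O) k e n h x +
      M.dist O.reverse (M.vertexBefore O x) (M.vertexBefore O (e 0)) := by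
  obtain ⟨f, hf⟩ := M.exists_lift O (S.slid_turn S.level_turn)
  have h1 := htr.le_dist (O := O) (f := f) (fun e => by
    rw [terminus_eq, origin_eq, hf, hf]
    exact S.slid_level_le _) (M.vertexBefore O (e 0)) (M.vertexBefore O x)
  rw [hf, hf] at h1
  have h2 := S.slid_level_path (Nat.zero_le k)
  rw [dist_reverse]
  omega

/-- The path itself gives the upper bound; the lower bound is that of the potential, which equals `k
- i` at `e i`. -/
theorem dist_path (htr : M.Transitive) {i : ℕ} (hi : i ≤ k) :
    M.dist O.reverse (M.vertexBefore O (e i)) (M.vertexBefore O (e 0)) = i := by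
  refine le_antisymm ?_ ?_
  · induction i with
    | zero => rw [dist_self]
    | succ i ih =>
      have h1 := htr.dist_contourIn O.reverse (M.vertexBefore O (e 0)) (e i)
      rw [vertexBefore_reverse, vertexBefore_reverse, contourIn_reverse,
        apply_inv_apply, vertexBefore_next S hi] at h1
      exact h1.trans (Nat.add_le_add_right (ih (by omega)) 1)
  · have h1 := le_slid_add_dist S htr (e i)
    have h2 := S.slid_level_path hi
    omega

theorem isCloser_path (htr : M.Transitive) {i : ℕ} (hi : i < k) {f : M.Edge} (hf : e i = Sum.inl f) :
    M.IsCloser O.reverse (M.vertexBefore O (e 0)) (Sum.inl f) := by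
  rw [isCloser_inl, terminus_reverse, origin_reverse, terminus_eq, origin_eq, ← hf,
    vertexBefore_next S hi, dist_path S htr hi.le, dist_path S htr hi]

/-- An edge met earlier and going closer would start, in the orientation `O`, at distance `i` from
`e 0`, hence at corrected level at least `k - i`; `exists_reverse_turn` gives at most `k - (i + 1)`.
-/
theorem isFirst_path (htr : M.Transitive) {i : ℕ} (hi : i + 1 < k) {f : M.Edge}
    (hf : e i = Sum.inl f) :
    M.IsFirst O.reverse (M.vertexBefore O (e 0)) (M.contourIn O.reverse (e (i + 1))) f := by
  obtain ⟨N, h1, h2⟩ := S.exists_reverse_turn hi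
  rw [← turnIn_reverse, ← contourIn_reverse] at h1 h2
  refine ⟨N, h1.trans hf, isCloser_path S htr (by omega) hf, fun l hl => ?_⟩
  rintro ⟨f', hf', hd⟩
  have h3 := h2 l hl
  have h4 := le_slid_add_dist S htr
    ((M.turnIn O.reverse ^ l) (M.contourIn O.reverse (e (i + 1))))
  have h5 : M.vertexBefore O.reverse (Sum.inl f') = M.vertexBefore O (e (i + 1)) := by
    rw [← hf', pow_apply_invariant (M.vertexBefore_turnIn O.reverse), vertexBefore_reverse,
      contourIn_reverse, apply_inv_apply]
  rw [terminus_reverse, origin_eq, origin_eq, h5, dist_path S htr hi.le, ← hf'] at hd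
  omega

/-- The reverse of the path is the lightest geodesic of the new map in the reverse orientation. -/
theorem lightestGeodesic_path (htr : M.Transitive) {g : ℕ → M.Edge}
    (hg : ∀ i < k, e i = Sum.inl (g i)) :
    M.lightestGeodesic O.reverse (Sum.inl (g (k - 1))) (M.vertexBefore O (e 0)) =
      (List.range k).map fun i => g (k - 1 - i) := by
  have hpos := S.pos
  have hk : M.dist O.reverse (M.vertexBefore O.reverse (Sum.inl (g (k - 1))))
      (M.vertexBefore O (e 0)) = k := by
    rw [vertexBefore_reverse, ← hg _ (by omega), vertexBefore_next S (by omega),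
      Nat.sub_add_cancel hpos, dist_path S htr le_rfl]
  rw [vertexBefore] at hk
  rw [lightestGeodesic, hk]
  refine geodesicSteps_eq (fun _ => ?_) fun i hi => ?_
  · exact ⟨0, rfl, isCloser_path S htr (by omega) (hg _ (by omega)),
      fun l hl => absurd hl (Nat.not_lt_zero l)⟩
  · have h1 := isFirst_path S htr (i := k - 1 - (i + 1)) (by omega) (hg _ (by omega))
    rwa [show k - 1 - (i + 1) + 1 = k - 1 - i by omega, hg (k - 1 - i) (by omega)] at h1

end MapData

/-! ### Reversibility of the operation -/

namespace Pointed

variable {r : ℕ} {O : Orientation} {t : Pointed r} {k : ℕ} {g : ℕ → t.map.Edge} {n : ℕ → ℕ}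

theorem slide_edge (hk : 0 < k) (hl : t.slidingPath O = (List.range k).map g) :
    (slide O t).edge = g (k - 1) := by
  change (t.slidingPath O).getLast?.getD t.edge = _
  rw [hl, getLast_map_range hk]

theorem rename_edge (hk : 0 < k) (hl : t.slidingPath O = (List.range k).map g)
    (hg0 : g 0 = t.edge) (hg : ∀ i < k, ∀ j < k, g i = g j → i = j) :
    t.rename O (Sum.inl t.edge) = Sum.inl (g (k - 1)) := by
  rw [← rename_path hl hg (show k - 1 < k by omega), Nat.sub_add_cancel hk, Nat.mod_self, hg0]

/-- The item that precedes the new distinguished corner. -/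
noncomputable def newMark (O : Orientation) (t : Pointed r) : t.map.Item :=
  t.rename O ((t.map.contourIn O)⁻¹ (Sum.inl t.edge))

theorem itemAfter_slide : ((slide O t).map.itemAfter O.reverse (slide O t).corner : t.map.Item) =
    t.newMark O :=
  (t.slidMap O).itemAfter_cornerAfter_reverse O (t.newMark O)

theorem contourIn_slide : ((slide O t).map.contourIn O.reverse : Perm t.map.Item) =
    (t.slidContour O)⁻¹ :=
  ((t.slidMap O).contourIn_reverse O).trans (congrArg (fun f : Perm t.map.Item => f⁻¹)
    (contourIn_slidMap O t))

theorem slidContour_newMark (h : t.Slidable O) :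
    t.slidContour O (t.newMark O) = t.shiftItem O (t.map.contourIn O (Sum.inl t.edge)) := by
  rw [newMark, slidContour_rename, inserted_eq, reinsert_before h.contour_ne_edge
    h.contour_ne_corner (apply_inv_apply _ _), shiftItem, if_neg h.contour_ne_corner]

/-- In the light-right orientation the new contour is stored inverted, and a double inverse has to
be removed. -/
theorem slitSlide_slidMap (S : SlitSlide (t.map.contourIn O) (t.map.crossDark O) (t.slidContour O)
    (t.shiftItem O) k (t.pathItem O k g) n (t.level O)) :
    SlitSlide (X := (t.slidMap O).Item) (t.map.contourIn O) ((t.slidMap O).crossDark O)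
      ((t.slidMap O).contourIn O) (t.shiftItem O) k (t.pathItem O k g) n (t.level O) := by
  cases O
  · exact S
  · have h1 : ((t.slidContour .lightRight)⁻¹)⁻¹ = t.slidContour .lightRight := inv_inv _
    rw [← h1] at S
    exact S

open Classical in
/-- The new faces, read on the old ones: the distinguished edge has moved to the face of the corner. -/
theorem Slidable.sameCycle_slidContour (h : t.Slidable O) {x : t.map.Item} (hx : x ≠ Sum.inl t.edge)
    (y : t.map.Item) :
    (t.slidContour O).SameCycle (t.rename O x) y ↔ (t.map.contourIn O).SameCycle x
      (if (t.rename O)⁻¹ y = Sum.inl t.edge then t.map.itemAfter O t.corner else (t.rename O)⁻¹ y) := by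
  rw [slidContour, Perm.sameCycle_conj, inv_apply_apply, inserted_eq,
    sameCycle_reinsert h.contour_ne_edge h.corner_ne h.contour_ne_corner hx]

theorem inv_contour_ne_edge (h : t.Slidable O) :
    (t.map.contourIn O)⁻¹ (Sum.inl t.edge) ≠ Sum.inl t.edge := by
  intro h1
  rw [Perm.inv_eq_iff_eq] at h1
  exact h.contour_ne_edge h1.symm

theorem Slidable.not_sameCycle_newMark (h : t.Slidable O) :
    ¬ (t.slidContour O).SameCycle (t.rename O (Sum.inl t.edge)) (t.newMark O) := by
  rw [Perm.sameCycle_comm, newMark, h.sameCycle_slidContour (inv_contour_ne_edge h),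
    inv_apply_apply, if_pos rfl, Perm.coe_inv, Perm.sameCycle_symm_apply_left]
  exact h.separated

/-- The slit-slide-sew operation can be reverted, and its sliding path is reversed. -/
theorem Slidable.slide (h : t.Slidable O) : (slide O t).Slidable O.reverse ∧
    (Hypermap.slide O t).slidingPath O.reverse = (t.slidingPath O).reverse ∧
    Nat.card t.map.Vertex ≤ Nat.card (Hypermap.slide O t).map.Vertex := by
  obtain ⟨k, g, n, hl, hg0, hinj, S⟩ := h.exists_slitSlide
  have hpos := S.pos
  have S' := slitSlide_slidMap S
  have htr : (t.slidMap O).Transitive := by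
    refine MapData.transitive_of_slitSlide S' fun q h1 h2 => ?_
    refine h.transitive.of_orientation O h1 ?_
    cases O <;> exact h2
  -- The corner left by the removed light side is at the start of the path, so it is the target of
  -- the reversed geodesic.
  have hw : (t.slidMap O).cornerVertex (Hypermap.slide O t).corner =
      (t.slidMap O).vertexBefore O (t.pathItem O k g 0) := by
    refine ((t.slidMap O).cornerVertex_cornerAfter O (t.newMark O)).trans ?_
    refine Eq.trans ?_ (MapData.vertexBefore_shift S' hpos)
    rw [pathItem_of_lt hpos, hg0]
    exact congrArg ((t.slidMap O).vertexBefore O) ((congrArg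
      (fun f : Perm t.map.Item => f (t.newMark O)) (contourIn_slidMap O t)).trans
        (slidContour_newMark h))
  have hedge := slide_edge hpos hl
  refine ⟨⟨htr, ?_, ?_⟩, ?_, ?_⟩
  · intro hs
    have h1 : (t.slidContour O)⁻¹.SameCycle (Sum.inl (g (k - 1))) (t.newMark O) := by
      rw [← contourIn_slide, ← itemAfter_slide, ← hedge]
      exact hs
    rw [Perm.sameCycle_inv, ← rename_edge hpos hl hg0 hinj] at h1
    exact h.not_sameCycle_newMark h1
  · have h1 := MapData.isCloser_path S' htr (i := k - 1) (by omega) (pathItem_of_lt (by omega))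
    rw [← hw, ← hedge] at h1
    exact h1
  · have h1 := MapData.lightestGeodesic_path S' htr (g := g) fun i hi => pathItem_of_lt hi
    rw [← hw, ← hedge] at h1
    exact (h1.trans (map_range_reverse k g)).trans (congrArg List.reverse hl.symm)
  · exact MapData.card_le_of_slitSlide S' (t.map.vertexBefore_turnIn O)
      (t.map.vertexBefore_surjective O)

/-- Since edges keep the names of their dark sides, sliding back gives equality and not only an
isomorphism. -/
theorem mk_eq_self (t : Pointed r) {κ : Perm (t.map.Edge ⊕ Fin r)} {c : t.map.Edge ⊕ Fin r}
    {e : t.map.Edge} (hκ : κ = t.map.contour) (hc : c = t.corner) (he : e = t.edge) :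
    (⟨⟨t.map.Edge, t.map.finite, κ, t.map.dark⟩, c, e⟩ : Pointed r) = t := by
  subst hκ hc he
  rfl

/-- Sliding forth and back does not change anything. -/
theorem Slidable.slide_slide (h : t.Slidable O) : Hypermap.slide O.reverse (Hypermap.slide O t) = t := by
  classical
  obtain ⟨k, g, n, hl, hg0, hinj, S⟩ := h.exists_slitSlide
  have hpos := S.pos
  obtain ⟨-, hpath, -⟩ := h.slide
  have hedge := slide_edge hpos hl
  set t' := Hypermap.slide O t with ht'
  -- The reversed path has the inverse cyclic shift, so the two renamings cancel.
  have hren : (t'.rename O.reverse : Perm t.map.Item) = (t.rename O)⁻¹ := by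
    have h1 : (t'.rename O.reverse : Perm t.map.Item) =
        Perm.sumCongr (t.slidingPath O).reverse.formPerm⁻¹ 1 :=
      congrArg (fun l : List t.map.Edge => (Perm.sumCongr l.formPerm⁻¹ 1 : Perm t.map.Item)) hpath
    rw [h1, rename, List.formPerm_reverse, Perm.sumCongr_inv, inv_one]
  have hcont : (t'.map.contourIn O.reverse : Perm t.map.Item) = (t.slidContour O)⁻¹ :=
    contourIn_slide
  have hedge' : t.rename O (Sum.inl t.edge) = Sum.inl t'.edge :=
    (rename_edge hpos hl hg0 hinj).trans (congrArg Sum.inl hedge.symm)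
  have hitem : (t'.map.itemAfter O.reverse t'.corner : t.map.Item) = t.newMark O :=
    itemAfter_slide
  have hins : (t'.inserted O.reverse : Perm t.map.Item) =
      t.rename O * (t.map.contourIn O)⁻¹ * (t.rename O)⁻¹ := by
    have h1 : (t'.inserted O.reverse : Perm t.map.Item) =
        reinsert (t.slidContour O)⁻¹ (t.rename O (Sum.inl t.edge)) (t.newMark O) := by
      rw [hedge', ← hcont, ← hitem]
      exact inserted_eq _ _
    have h2 : (t.slidContour O)⁻¹ = t.rename O * (t.inserted O)⁻¹ * (t.rename O)⁻¹ := by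
      rw [slidContour]
      group
    rw [h1, h2, newMark, reinsert_conj, inserted_eq, reinsert_reinsert h.corner_ne h.contour_ne_corner]
  have hslid : (t'.slidContour O.reverse : Perm t.map.Item) = (t.map.contourIn O)⁻¹ := by
    have h1 : (t'.slidContour O.reverse : Perm t.map.Item) =
        (t.rename O)⁻¹ * (t.rename O * (t.map.contourIn O)⁻¹ * (t.rename O)⁻¹) *
          ((t.rename O)⁻¹)⁻¹ := by
      rw [← hins, ← hren]
      rfl
    exact h1.trans (inv_conj_conj _ _)
  have hκ : ((t'.slidMap O.reverse).contour : Perm t.map.Item) = t.map.contour := by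
    cases O
    · exact (congrArg (fun f : Perm t.map.Item => f⁻¹) hslid).trans (inv_inv _)
    · exact hslid.trans (inv_inv _)
  refine mk_eq_self t hκ ?_ ?_
  · have h1 : (t'.rename O.reverse ((t'.map.contourIn O.reverse)⁻¹ (Sum.inl t'.edge)) : t.map.Item) =
        t.map.itemAfter O t.corner := by
      have h2 : (t'.rename O.reverse ((t'.map.contourIn O.reverse)⁻¹ (Sum.inl t'.edge)) : t.map.Item) =
          (t.rename O)⁻¹ (((t.slidContour O)⁻¹)⁻¹ (t.rename O (Sum.inl t.edge))) := by
        rw [← hren, ← hcont, hedge']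
        rfl
      rw [h2, inv_inv, slidContour_rename, inv_apply_apply, inserted_eq, reinsert_self]
    have h2 : ∀ x : t.map.Item, ((t'.slidMap O.reverse).cornerAfter O.reverse x : t.map.Item) =
        t.map.cornerAfter O.reverse x := by
      intro x
      cases O
      · rfl
      · exact congrArg (fun f : Perm t.map.Item => f x) hκ
    exact ((congrArg (fun x : t.map.Item => (t'.slidMap O.reverse).cornerAfter O.reverse x) h1).trans
      (h2 _)).trans (t.map.cornerAfter_reverse_itemAfter O t.corner)
  · have h1 : ((t'.slidingPath O.reverse).getLast?.getD t'.edge : t.map.Edge) =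
        ((List.range k).map fun i => g (k - 1 - i)).getLast?.getD t'.edge := by
      rw [map_range_reverse, ← hl, ← hpath]
      rfl
    refine h1.trans ((getLast_map_range hpos (fun i => g (k - 1 - i)) _).trans ?_)
    rw [Nat.sub_self, hg0]

end Pointed

/-! ### Preservation of the hypermap axioms and of the type -/

namespace MapData

variable {r : ℕ} {m : MapData r}

/-- An invariant predicate descends to vertices, and is then constant along edges. -/
theorem transitive_of_connected (h : ∀ v w : m.Vertex, Relation.EqvGen
    (fun x y => ∃ e, m.origin .lightLeft e = x ∧ m.terminus .lightLeft e = y) v w) :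
    m.Transitive := by
  intro q h1 h2 x y
  have hturn : ∀ x, q (m.turnIn .lightLeft x) = q x := by
    intro x
    refine (h1 _).trans ?_
    cases x with
    | inl e => exact inv_invariant (f := m.dark) (q := fun e => q (Sum.inl e)) h2 e
    | inr i => rfl
  obtain ⟨f, hf⟩ := m.exists_lift .lightLeft hturn
  have h3 := h (m.vertexBefore .lightLeft x) (m.vertexBefore .lightLeft y)
  rw [← hf, ← hf]
  generalize m.vertexBefore .lightLeft x = v at h3 ⊢
  generalize m.vertexBefore .lightLeft y = w at h3 ⊢
  induction h3 with
  | rel u v huv =>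
    obtain ⟨e, rfl, rfl⟩ := huv
    rw [terminus_eq, origin_eq, hf, hf]
    exact (h1 _).symm
  | refl u => rfl
  | symm u v _ ih => exact ih.symm
  | trans u v w _ _ ih ih' => exact ih.trans ih'

theorem Transitive.connected (h : m.Transitive) (v w : m.Vertex) : Relation.EqvGen
    (fun x y => ∃ e, m.origin .lightLeft e = x ∧ m.terminus .lightLeft e = y) v w := by
  obtain ⟨l, hl⟩ := h.exists_isPath .lightLeft v w
  induction l generalizing v with
  | nil => cases hl; exact .refl _
  | cons e l ih => exact .trans _ _ _ (.rel _ _ ⟨e, hl.1, rfl⟩) (ih _ hl.2)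

theorem sameCycle_contourIn (O : Orientation) {x y : m.Item} :
    (m.contourIn O).SameCycle x y ↔ m.contour.SameCycle x y := by
  cases O
  · exact Iff.rfl
  · exact Perm.sameCycle_inv

theorem sameCycle_itemAfter (O : Orientation) {x : m.Item} {c : m.Corner} :
    m.contour.SameCycle x (m.itemAfter O c) ↔ m.contour.SameCycle x c := by
  cases O
  · exact Iff.rfl
  · exact Perm.sameCycle_symm_apply_right

theorem sameCycle_cornerAfter (O : Orientation) {x y : m.Item} :
    m.contour.SameCycle x (m.cornerAfter O y) ↔ m.contour.SameCycle x y := by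
  cases O
  · exact Perm.sameCycle_apply_right
  · exact Iff.rfl

theorem isCloser_reverse_iff (O : Orientation) (v : m.Vertex) (e : m.Edge) :
    m.IsCloser O.reverse v (Sum.inl e) ↔ m.IsLeaving O v e := by
  rw [isCloser_inl, terminus_reverse, origin_reverse, dist_reverse, dist_reverse, IsLeaving, eq_comm]

end MapData

namespace Pointed

variable {r : ℕ}

/-- The pointed maps representing the elements of `pointedHypermaps`. -/
structure IsPointedHypermap (p : ℕ) (a : Fin r → ℕ) (O : Orientation) (i j : Fin r)
    (t : Pointed r) : Prop where
  isHypermap : t.map.IsHypermap p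
  hasType : t.map.HasType a
  corner_mem : t.map.CornerInFace i t.corner
  edge_mem : t.map.EdgeInFace j t.edge
  leaving : t.map.IsLeaving O (t.map.cornerVertex t.corner) t.edge

/-- Transferring one degree from the face `j` to the face `i`. -/
def moveDegree (a : Fin r → ℕ) (j i : Fin r) : Fin r → ℕ :=
  Function.update (Function.update a j (a j - 1)) i (a i + 1)

variable {p : ℕ} {a : Fin r → ℕ} {O : Orientation} {i j : Fin r} {t : Pointed r}

theorem IsPointedHypermap.eq_of_sameCycle (h : t.IsPointedHypermap p a O i j) {l l' : Fin r}
    {x : t.map.Item} (hx : t.map.contour.SameCycle (Sum.inr l) x)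
    (hx' : t.map.contour.SameCycle (Sum.inr l') x) : l = l' :=
  (h.isHypermap.existsUnique_mark x).unique hx hx'

theorem IsPointedHypermap.slidable (h : t.IsPointedHypermap p a O.reverse i j) (hij : i ≠ j) :
    t.Slidable O where
  transitive := MapData.transitive_of_connected h.isHypermap.connected
  separated := by
    rw [MapData.sameCycle_contourIn, MapData.sameCycle_itemAfter]
    exact fun hs => hij (h.eq_of_sameCycle h.corner_mem (h.edge_mem.trans hs))
  closer := by
    have h1 := (MapData.isCloser_reverse_iff O.reverse _ _).2 h.leaving
    rwa [Orientation.reverse_reverse] at h1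

open Classical in
theorem Slidable.sameCycle_slidMap (h : t.Slidable O) (l : Fin r) (y : t.map.Item) :
    (t.slidMap O).contour.SameCycle (Sum.inr l) y ↔ t.map.contour.SameCycle (Sum.inr l)
      (if (t.rename O)⁻¹ y = Sum.inl t.edge then t.corner else (t.rename O)⁻¹ y) := by
  have h1 := h.sameCycle_slidContour (x := Sum.inr l) (by simp) y
  rw [← contourIn_slidMap] at h1
  refine ((MapData.sameCycle_contourIn (m := t.slidMap O) O).symm.trans h1).trans ?_
  rw [MapData.sameCycle_contourIn]
  split_ifs
  · exact MapData.sameCycle_itemAfter O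
  · exact Iff.rfl

theorem hasType_slidMap (h : t.IsPointedHypermap p a O.reverse i j) (hij : i ≠ j) :
    (t.slidMap O).HasType (moveDegree a j i) := by
  classical
  intro l
  have hs := h.slidable hij
  have hF : ∀ l, Set.ncard {e | t.map.EdgeInFace l e} = a l := h.hasType
  have hj : ∀ l, t.map.EdgeInFace l t.edge ↔ l = j := fun l =>
    ⟨fun h1 => h.eq_of_sameCycle h1 h.edge_mem, fun h1 => h1 ▸ h.edge_mem⟩
  have hi : ∀ l, t.map.CornerInFace l t.corner ↔ l = i := fun l =>
    ⟨fun h1 => h.eq_of_sameCycle h1 h.corner_mem, fun h1 => h1 ▸ h.corner_mem⟩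
  -- Undoing the renaming by `formPerm` compares light sides under their old names: only that of the
  -- distinguished edge has changed face.
  have h1 : Nat.card {e : t.map.Edge // (t.slidMap O).EdgeInFace l e} =
      Set.ncard {e | if e = t.edge then l = i else t.map.EdgeInFace l e} := by
    refine Nat.card_congr (Equiv.subtypeEquiv (t.slidingPath O).formPerm fun e => ?_)
    refine (hs.sameCycle_slidMap l (Sum.inl e)).trans ?_
    have h2 : (t.rename O)⁻¹ (Sum.inl e) = Sum.inl ((t.slidingPath O).formPerm e) := by
      rw [rename, Perm.sumCongr_inv, inv_inv]
      rfl
    rw [h2]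
    by_cases h3 : (t.slidingPath O).formPerm e = t.edge
    · simp only [h3, if_true, Set.mem_ofPred_eq]
      exact hi l
    · rw [if_neg (fun h4 => h3 (Sum.inl.inj h4))]
      simp [h3, MapData.EdgeInFace]
  refine h1.trans ?_
  have : Finite t.map.Edge := t.map.finite
  by_cases hli : l = i
  · subst hli
    have h2 : {e | if e = t.edge then l = l else t.map.EdgeInFace l e} =
        insert t.edge {e | t.map.EdgeInFace l e} := by
      ext e
      by_cases he : e = t.edge <;> simp [he]
    rw [h2, Set.ncard_insert_of_notMem (by simpa [hj] using hij), hF, moveDegree,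
      Function.update_self]
  · rw [moveDegree, Function.update_of_ne hli]
    by_cases hlj : l = j
    · subst hlj
      have h2 : {e | if e = t.edge then l = i else t.map.EdgeInFace l e} =
          {e | t.map.EdgeInFace l e} \ {t.edge} := by
        ext e
        by_cases he : e = t.edge <;> simp [he, hli]
      rw [h2, Set.ncard_sdiff_singleton_of_mem (by simp [hj]), hF, Function.update_self]
    · rw [Function.update_of_ne hlj, ← hF]
      congr 1
      ext e
      by_cases he : e = t.edge <;> simp [he, hli, hlj, hj]

/-- The slit-slide-sew operation transfers one degree from the face of the distinguished edge to
the face of the distinguished corner, and exchanges the roles of these faces. -/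
theorem IsPointedHypermap.slide (h : t.IsPointedHypermap p a O.reverse i j) (hij : i ≠ j)
    (ha : ∀ l, 0 < a l) (haj : 2 ≤ a j) :
    (Hypermap.slide O t).IsPointedHypermap p (moveDegree a j i) O j i := by
  classical
  have hs := h.slidable hij
  obtain ⟨hs', -, hcard⟩ := hs.slide
  -- Sliding back supplies the opposite inequality between numbers of vertices.
  obtain ⟨-, -, hcard'⟩ := hs'.slide
  rw [hs.slide_slide] at hcard'
  have htype : (t.slidMap O).HasType (moveDegree a j i) := hasType_slidMap h hij
  obtain ⟨k, g, n, hl, hg0, hinj, S⟩ := hs.exists_slitSlide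
  have hedge : t.rename O (Sum.inl t.edge) = Sum.inl (Hypermap.slide O t).edge :=
    (rename_edge S.pos hl hg0 hinj).trans (congrArg Sum.inl (slide_edge S.pos hl).symm)
  -- The face `j` loses an edge and must keep one, hence `2 ≤ a j`. A face with an edge cannot have
  -- its mark as a fixed point of the contour.
  have hpos : ∀ l, 0 < moveDegree a j i l := by
    intro l
    rw [moveDegree, Function.update_apply, Function.update_apply]
    have := ha l
    split_ifs <;> omega
  refine ⟨⟨fun x => ?_, fun l hl => ?_, h.isHypermap.dark_degree, hs'.transitive.connected, ?_⟩,
    htype, ?_, ?_, (MapData.isCloser_reverse_iff O _ _).1 hs'.closer⟩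
  · have h1 := h.isHypermap.existsUnique_mark (if (t.rename O)⁻¹ x = Sum.inl t.edge then t.corner
      else (t.rename O)⁻¹ x)
    exact (existsUnique_congr fun l => hs.sameCycle_slidMap l x).2 h1
  · have h1 := hpos l
    rw [← htype l] at h1
    obtain ⟨⟨e, he⟩⟩ := (Nat.card_pos_iff.1 h1).1
    have h2 := Perm.SameCycle.eq_of_left he hl
    cases h2
  · have h1 := h.isHypermap.euler
    have h2 : Nat.card (Hypermap.slide O t).map.Vertex = Nat.card t.map.Vertex :=
      le_antisymm hcard' hcard
    rw [h2]
    exact h1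
  · refine (MapData.sameCycle_cornerAfter (m := t.slidMap O) O (y := t.newMark O)).2 ?_
    refine (hs.sameCycle_slidMap j (t.newMark O)).2 ?_
    rw [newMark, inv_apply_apply, if_neg (inv_contour_ne_edge hs),
      ← MapData.sameCycle_contourIn O, Perm.coe_inv, Perm.sameCycle_symm_apply_right,
      MapData.sameCycle_contourIn]
    exact h.edge_mem
  · have h1 := hs.sameCycle_slidMap i (t.rename O (Sum.inl t.edge))
    rw [inv_apply_apply, if_pos rfl, hedge] at h1
    exact h1.2 h.corner_mem

end Pointed

/-! ### The bijection on isomorphism classes -/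

/-- The action of `Phi` on the second components. -/
noncomputable def slideClass {r : ℕ} (O : Orientation) : PointedClass r → PointedClass r :=
  Quotient.map (slide O) fun _ _ h => slide_iso O h

theorem slideClass_maps {p r : ℕ} {a : Fin r → ℕ} {O : Orientation} {i j : Fin r} (hij : i ≠ j)
    (ha : ∀ l, 0 < a l) (haj : 2 ≤ a j) {x : PointedClass r}
    (hx : x ∈ pointedHypermaps p a O.reverse i j) :
    slideClass O x ∈ pointedHypermaps p (Pointed.moveDegree a j i) O j i ∧
      slideClass O.reverse (slideClass O x) = x := by
  obtain ⟨t, ⟨h1, h2, h3, h4, h5⟩, rfl⟩ := hx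
  have h : t.IsPointedHypermap p a O.reverse i j := ⟨h1, h2, h3, h4, h5⟩
  obtain ⟨k1, k2, k3, k4, k5⟩ := h.slide hij ha haj
  refine ⟨⟨slide O t, ⟨k1, k2, k3, k4, k5⟩, rfl⟩, ?_⟩
  exact congrArg (Quotient.mk (Pointed.setoid r)) (h.slidable hij).slide_slide

/-- The situation is symmetric: moving the degree back restores `a`, and face `i` has degree at
least two after receiving one, so the backward operation satisfies the same hypotheses. -/
theorem bijOn_slideClass {p r : ℕ} {a : Fin r → ℕ} {O : Orientation} {i j : Fin r} (hij : i ≠ j)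
    (ha : ∀ l, 0 < a l) (haj : 2 ≤ a j) :
    Set.BijOn (slideClass O.reverse) (pointedHypermaps p a O i j)
      (pointedHypermaps p (Pointed.moveDegree a j i) O.reverse j i) := by
  have hmove : Pointed.moveDegree (Pointed.moveDegree a j i) i j = a := by
    funext l
    simp only [Pointed.moveDegree, Function.update_apply, if_neg hij.symm, if_pos]
    split_ifs with h1 h2
    · subst h1; omega
    · subst h2; omega
    · rfl
  have ha' : ∀ l, 0 < Pointed.moveDegree a j i l := by
    intro l
    rw [Pointed.moveDegree, Function.update_apply, Function.update_apply]
    have := ha l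
    split_ifs <;> omega
  have hai' : 2 ≤ Pointed.moveDegree a j i i := by
    rw [Pointed.moveDegree, Function.update_self]
    have := ha i
    omega
  have h1 : ∀ x ∈ pointedHypermaps p a O i j, _ := fun x hx =>
    slideClass_maps (O := O.reverse) hij ha haj (by rwa [Orientation.reverse_reverse])
  have h2 : ∀ x ∈ pointedHypermaps p (Pointed.moveDegree a j i) O.reverse j i, _ := fun x hx =>
    slideClass_maps (O := O) hij.symm ha' hai' hx
  rw [hmove] at h2
  rw [Orientation.reverse_reverse] at h1
  exact Set.InvOn.bijOn (f' := slideClass O) ⟨fun x hx => (h1 x hx).2, fun x hx => (h2 x hx).2⟩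
    (fun x hx => (h1 x hx).1) fun x hx => (h2 x hx).1

end Hypermap

theorem corollary1 (p r : ℕ) (hp : 2 ≤ p) (a : Fin (r + 2) → ℕ) (ha : ∀ i, 0 < a i)
    (ha0 : 2 ≤ a 0)
    (hmod :
      (∃ k : ℕ, k < p ∧ (a 0 : ZMod p) = k ∧ (a 1 : ZMod p) = -k ∧
        ∀ i, i ≠ 0 → i ≠ 1 → (a i : ZMod p) = 0) ∨
      ((a 0 : ZMod p) = 1 ∧ ∃ j, j ≠ 0 ∧ j ≠ 1 ∧ (a j : ZMod p) = -1 ∧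
        ∀ i, i ≠ 0 → i ≠ j → (a i : ZMod p) = 0))
    (O : Hypermap.Orientation) :
    let M : Set (Hypermap.PointedClass (r + 2)) :=
      Hypermap.pointedHypermaps p a O (cornerFace := 1) (edgeFace := 0)
    let M' : Set (Hypermap.PointedClass (r + 2)) :=
      Hypermap.pointedHypermaps p (Hypermap.transfer a) O.reverse (cornerFace := 0) (edgeFace := 1)
    Set.BijOn Hypermap.Phi {q | q.1 = O ∧ q.2 ∈ M} {q | q.1 = O.reverse ∧ q.2 ∈ M'} ∧
      Set.BijOn (fun t => (Hypermap.Phi (O, t)).2) M M' := by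
  intro M M'
  -- By definition, `transfer a` is `moveDegree a 0 1`, and `slideClass O.reverse` is the second
  -- component of `Phi` at `O`.
  have h : Set.BijOn (Hypermap.slideClass O.reverse) M M' :=
    Hypermap.bijOn_slideClass (by simp) ha ha0
  refine ⟨⟨?_, ?_, ?_⟩, h⟩
  · rintro ⟨O', x⟩ ⟨rfl, hx⟩
    exact ⟨rfl, h.mapsTo hx⟩
  · rintro ⟨O', x⟩ ⟨rfl, hx⟩ ⟨O'', y⟩ ⟨hO, hy⟩ hxy
    obtain rfl : O'' = O' := hO
    exact Prod.ext rfl (h.injOn hx hy (congrArg Prod.snd hxy))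
  · rintro ⟨O', y⟩ ⟨rfl, hy⟩
    obtain ⟨x, hx, rfl⟩ := h.surjOn hy
    exact ⟨(O, x), ⟨rfl, hx⟩, rfl⟩
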